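/- Let $p$ be a prime, let $\mathbb C_p$ be the field of $p$-adic complex numbers with its $p$-adic absolute value $|\cdot|$, $O_p=\{|z|\le 1\}$ its ring of integers, $\mathfrak c_p=\{|z|<1\}$ the maximal ideal and $k=O_p/\mathfrak c_p$ the residue field. For $x=[X],y=[Y]\in\mathbb P^n(\mathbb C_p)$, with homogeneous coordinates normalized by $\max_i|X_i|=\max_i|Y_i|=1$, put $\Delta(x,y)=\max_{i,j}|X_iY_j-X_jY_i|$. Let $C\subseteq\mathbb P^n(\mathbb C_p)$ be an irreducible smooth projective curve with ideal of relations $I=I(C)\subset\mathbb C_p[T_0,\dots,T_n]$. Let $\overline J\subset k[T_0,\dots,T_n]$ be the reduction modulo $\mathfrak c_p$ of $J=I\cap O_p[T_0,\dots,T_n]$, and $\overline C\subset\mathbb P^n(k)$ its zero locus. Assume that $C$ has good reduction: at every point of $\overline C$, the Jacobian matrix of (generators of) $\overline J$ in affine coordinates has rank $n-1$. Let $\phi:C\to C$ be a morphism, defined by forms $F_0,\dots,F_n\in\mathbb C_p[T_0,\dots,T_n]$ of the same degree, not all in $I$. Assume that $\phi$ has good reduction: for every $\bar x=[\bar X]\in\overline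 C$ there are forms $G_0,\dots,G_n\in O_p[T_0,\dots,T_n]$ of the same degree with $F_iG_j-F_jG_i\in I$ for all $i,j$, whose reductions do not all vanish at $\bar X$. Assume also that $\phi$ has degree $d=[K:\phi^*(K)]>1$, where $K$ is the field of rational functions on $C$. Then for every point $x\in C$ and every real $r<1$, the number of points $y\in C$ that are periodic under $\phi$ and satisfy $\Delta(x,y)<r$ is finite. In particular, the periodic points of $\phi$ form a discrete set in the $\Delta$-metric: for every periodic point $y$ there is $\varepsilon>0$ such that no periodic point $y'\ne y$ satisfies $\Delta(y,y')<\varepsilon$. -/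

import Mathlib

open scoped LinearAlgebra.Projectivization

noncomputable section

namespace CurveDynamics

/-! ### The distance on projective space over `ℂ_[p]` -/

section Distance

variable (p : ℕ) [Fact p.Prime] {n : ℕ}

/-- The distance `Δ(x, y) = max_{i,j} |X_i Y_j - X_j Y_i| / (|X| |Y|)` on `ℙⁿ(ℂ_p)`, where `X`, `Y`
are any homogeneous coordinates of `x`, `y` and `|X| = max_i |X_i|` (the norms on the finite
products below are maximum norms). By `Delta_mk` the choice of `X` and `Y` does not matter, and by
`Delta_mk_of_norm_eq_one` the denominator may be dropped if `|X| = |Y| = 1`. -/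
def Delta (x y : ℙ ℂ_[p] (Fin (n + 1) → ℂ_[p])) : ℝ :=
  ‖fun ij : Fin (n + 1) × Fin (n + 1) => x.rep ij.1 * y.rep ij.2 - x.rep ij.2 * y.rep ij.1‖ /
    (‖x.rep‖ * ‖y.rep‖)

theorem Delta_mk (X Y : Fin (n + 1) → ℂ_[p]) (hX : X ≠ 0) (hY : Y ≠ 0) :
    Delta p (Projectivization.mk ℂ_[p] X hX) (Projectivization.mk ℂ_[p] Y hY) =
      ‖fun ij : Fin (n + 1) × Fin (n + 1) => X ij.1 * Y ij.2 - X ij.2 * Y ij.1‖ /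
        (‖X‖ * ‖Y‖) := by
  obtain ⟨a, ha⟩ := Projectivization.exists_smul_eq_mk_rep ℂ_[p] X hX
  obtain ⟨b, hb⟩ := Projectivization.exists_smul_eq_mk_rep ℂ_[p] Y hY
  have ha0 : ‖(a : ℂ_[p])‖ ≠ 0 := norm_ne_zero_iff.mpr a.ne_zero
  have hb0 : ‖(b : ℂ_[p])‖ ≠ 0 := norm_ne_zero_iff.mpr b.ne_zero
  have hX0 : ‖X‖ ≠ 0 := norm_ne_zero_iff.mpr hX
  have hY0 : ‖Y‖ ≠ 0 := norm_ne_zero_iff.mpr hY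
  have key : (fun ij : Fin (n + 1) × Fin (n + 1) =>
      (a • X) ij.1 * (b • Y) ij.2 - (a • X) ij.2 * (b • Y) ij.1) =
      ((a : ℂ_[p]) * b) • fun ij : Fin (n + 1) × Fin (n + 1) =>
        X ij.1 * Y ij.2 - X ij.2 * Y ij.1 := by
    funext ij
    simp only [Pi.smul_apply, Units.smul_def, smul_eq_mul]
    ring
  have hnX : ‖a • X‖ = ‖(a : ℂ_[p])‖ * ‖X‖ := by rw [Units.smul_def, norm_smul]
  have hnY : ‖b • Y‖ = ‖(b : ℂ_[p])‖ * ‖Y‖ := by rw [Units.smul_def, norm_smul]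
  rw [Delta, ← ha, ← hb, key, norm_smul, norm_mul, hnX, hnY]
  field_simp

theorem Delta_mk_of_norm_eq_one (X Y : Fin (n + 1) → ℂ_[p]) (hX : X ≠ 0) (hY : Y ≠ 0)
    (hX1 : ‖X‖ = 1) (hY1 : ‖Y‖ = 1) :
    Delta p (Projectivization.mk ℂ_[p] X hX) (Projectivization.mk ℂ_[p] Y hY) =
      ‖fun ij : Fin (n + 1) × Fin (n + 1) => X ij.1 * Y ij.2 - X ij.2 * Y ij.1‖ := by
  rw [Delta_mk, hX1, hY1, mul_one, div_one]

end Distance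

/-! ### Projective curves over a field -/

section Curves

variable {k : Type*} [Field k] {n : ℕ}

/-- The ideal of relations of a set of points of `ℙⁿ(k)`: the polynomials that vanish at all
homogeneous coordinates of all points of the set. -/
def relationIdeal (S : Set (ℙ k (Fin (n + 1) → k))) : Ideal (MvPolynomial (Fin (n + 1)) k) :=
  MvPolynomial.vanishingIdeal k
    {X : Fin (n + 1) → k | ∃ hX : X ≠ 0, Projectivization.mk k X hX ∈ S}

/-- The Jacobian criterion for a homogeneous ideal `I` of `k[T_0, …, T_n]`. At every point `[X]` of
the projective zero locus of `I`, and in every affine chart `T_i ≠ 0` that contains it (with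
coordinates normalized by `X_i = 1`), the gradients at `X` of the dehomogenized elements of `I`,
taken with respect to the `n` affine coordinates `T_j`, `j ≠ i`, span a space of
dimension `n - 1`. -/
def IsNonsingular (I : Ideal (MvPolynomial (Fin (n + 1)) k)) : Prop :=
  ∀ (X : Fin (n + 1) → k) (i : Fin (n + 1)), X i = 1 →
    (∀ f ∈ I, MvPolynomial.eval X f = 0) →
    Module.finrank k (Submodule.span k
      {v : {j : Fin (n + 1) // j ≠ i} → k |
        ∃ f ∈ I, v = fun j => MvPolynomial.eval X (MvPolynomial.pderiv j.1 f)}) + 1 = n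

variable (k n) in
/-- An irreducible projective curve in `ℙⁿ(k)`: a set of points that is the zero locus of its ideal
of relations, whose ideal of relations is prime, and whose homogeneous coordinate ring has Krull
dimension two. -/
structure ProjectiveCurve where
  carrier : Set (ℙ k (Fin (n + 1) → k))
  isClosed : ∀ (X : Fin (n + 1) → k) (hX : X ≠ 0),
    (∀ f ∈ relationIdeal carrier, MvPolynomial.eval X f = 0) →
      Projectivization.mk k X hX ∈ carrier
  isPrime : (relationIdeal carrier).IsPrime
  dimension : ringKrullDim (MvPolynomial (Fin (n + 1)) k ⧸ relationIdeal carrier) = 2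

namespace ProjectiveCurve

variable (C : ProjectiveCurve k n)

/-- The ideal of relations `I(C)`. -/
abbrev ideal : Ideal (MvPolynomial (Fin (n + 1)) k) := relationIdeal C.carrier

instance : C.ideal.IsPrime := C.isPrime

/-- The curve is smooth: non-singular at every point. -/
def IsSmooth : Prop := IsNonsingular C.ideal

/-- The field of fractions of the homogeneous coordinate ring `k[T_0, …, T_n] / I(C)`. -/
abbrev CoordField : Type _ := FractionRing (MvPolynomial (Fin (n + 1)) k ⧸ C.ideal)

/-- The class of a polynomial in the field of fractions of the homogeneous coordinate ring. -/
def toCoordField (F : MvPolynomial (Fin (n + 1)) k) : C.CoordField :=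
  algebraMap (MvPolynomial (Fin (n + 1)) k ⧸ C.ideal) C.CoordField (Ideal.Quotient.mk C.ideal F)

end ProjectiveCurve

/-- Given elements `P_0, …, P_n` of an extension field `L` of `k`, the field of all quotients
`F(P_0, …, P_n) / G(P_0, …, P_n)` with forms `F`, `G` over `k` of the same degree such that
`G(P_0, …, P_n) ≠ 0`. -/
def ratioField {L : Type*} [Field L] [Algebra k L] (P : Fin (n + 1) → L) :
    IntermediateField k L where
  carrier := {a | ∃ (m : ℕ) (F G : MvPolynomial (Fin (n + 1)) k), F.IsHomogeneous m ∧
    G.IsHomogeneous m ∧ MvPolynomial.aeval P G ≠ 0 ∧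
    a = MvPolynomial.aeval P F / MvPolynomial.aeval P G}
  mul_mem' := by
    rintro a b ⟨m, F, G, hF, hG, hG0, rfl⟩ ⟨m', F', G', hF', hG', hG0', rfl⟩
    refine ⟨m + m', F * F', G * G', hF.mul hF', hG.mul hG', ?_, ?_⟩
    · rw [map_mul]
      exact mul_ne_zero hG0 hG0'
    · rw [map_mul, map_mul, div_mul_div_comm]
  add_mem' := by
    rintro a b ⟨m, F, G, hF, hG, hG0, rfl⟩ ⟨m', F', G', hF', hG', hG0', rfl⟩
    refine ⟨m + m', F * G' + G * F', G * G', (hF.mul hG').add (hG.mul hF'), hG.mul hG', ?_, ?_⟩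
    · rw [map_mul]
      exact mul_ne_zero hG0 hG0'
    · rw [map_add, map_mul, map_mul, map_mul, div_add_div _ _ hG0 hG0']
  algebraMap_mem' := by
    intro c
    refine ⟨0, MvPolynomial.C c, 1, MvPolynomial.isHomogeneous_C _ c,
      MvPolynomial.isHomogeneous_one _ _, ?_, ?_⟩
    · simp
    · simp
  inv_mem' := by
    rintro a ⟨m, F, G, hF, hG, hG0, rfl⟩
    by_cases hF0 : MvPolynomial.aeval P F = 0
    · exact ⟨m, F, G, hF, hG, hG0, by simp [hF0]⟩
    · exact ⟨m, G, F, hG, hF, hF0, by rw [inv_div]⟩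

/-- The field of rational functions of a curve: all quotients `F / G` of classes of forms `F`, `G`
of the same degree with `G ∉ I(C)`. -/
def ProjectiveCurve.functionField (C : ProjectiveCurve k n) : IntermediateField k C.CoordField :=
  ratioField fun i => C.toCoordField (MvPolynomial.X i)

/-- The tuple `(F_0, …, F_n)` consists of forms of one common degree. -/
def IsFormTuple {R : Type*} [CommSemiring R] (F : Fin (n + 1) → MvPolynomial (Fin (n + 1)) R) :
    Prop :=
  ∃ m : ℕ, ∀ i, (F i).IsHomogeneous m

/-- A morphism `φ : C → C`. It is defined by forms `F_0, …, F_n` of the same degree, not all in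
`I(C)`, such that at each point `x = [X]` of `C` there is a representation by forms `G_0, …, G_n` of
the same degree with `F_i G_j - F_j G_i ∈ I(C)` for all `i, j`, with `(G_0(X), …, G_n(X)) ≠ 0`, and
with `φ(x) = [G_0(X), …, G_n(X)]`. -/
structure SelfMorphism (C : ProjectiveCurve k n) where
  toFun : C.carrier → C.carrier
  form : Fin (n + 1) → MvPolynomial (Fin (n + 1)) k
  isFormTuple : IsFormTuple form
  exists_notMem : ∃ j, form j ∉ C.ideal
  exists_representation : ∀ x : C.carrier, ∃ G : Fin (n + 1) → MvPolynomial (Fin (n + 1)) k,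
    IsFormTuple G ∧ (∀ i j, form i * G j - form j * G i ∈ C.ideal) ∧
    ∃ hG : (fun i => MvPolynomial.eval x.1.rep (G i)) ≠ 0,
      (toFun x).1 = Projectivization.mk k (fun i => MvPolynomial.eval x.1.rep (G i)) hG

namespace SelfMorphism

variable {C : ProjectiveCurve k n} (φ : SelfMorphism C)

/-- The field `φ^*(K)` of all functions `f ∘ φ = F(F_0, …, F_n) / G(F_0, …, F_n)`, where `f = F / G`
is a rational function on `C` and `(F_0, …, F_n)` are the forms that define `φ`. -/
def pullbackField : IntermediateField k C.CoordField :=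
  ratioField fun i => C.toCoordField (φ.form i)

theorem pullbackField_le : φ.pullbackField ≤ C.functionField := by
  have key : ∀ P : Fin (n + 1) → MvPolynomial (Fin (n + 1)) k, ∀ F : MvPolynomial (Fin (n + 1)) k,
      MvPolynomial.aeval (fun i => C.toCoordField (P i)) F =
        C.toCoordField (MvPolynomial.bind₁ P F) := by
    intro P F
    have h : ∀ G, C.toCoordField G = (Algebra.ofId _ C.CoordField).restrictScalars k
        (Ideal.Quotient.mkₐ k C.ideal G) := fun G => rfl
    simp only [h]
    rw [← AlgHom.comp_apply, ← AlgHom.comp_apply]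
    refine DFunLike.congr_fun ?_ F
    ext i
    simp
  obtain ⟨d, hd⟩ := φ.isFormTuple
  have hX : ∀ F, MvPolynomial.aeval (fun i => C.toCoordField (MvPolynomial.X i)) F =
      C.toCoordField F := by
    intro F
    rw [key]
    simp
  rintro a ⟨m, F, G, hF, hG, hG0, rfl⟩
  refine ⟨d * m, MvPolynomial.bind₁ φ.form F, MvPolynomial.bind₁ φ.form G, ?_, ?_, ?_, ?_⟩
  · exact hF.aeval φ.form hd
  · exact hG.aeval φ.form hd
  · rwa [hX, ← key]
  · rw [hX, hX, ← key, ← key]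

/-- The degree `[K : φ^*(K)]` of the morphism (zero if `φ` is constant). By `pullbackField_le`,
`φ^*(K)` is contained in `K`, so that the relative degree below is the degree of the field
extension `K / φ^*(K)`. -/
def degree : ℕ := IntermediateField.relfinrank φ.pullbackField C.functionField

end SelfMorphism

end Curves

/-! ### Good reduction -/

section Reduction

variable (p : ℕ) [Fact p.Prime] {n : ℕ}

theorem mem_integers_iff (z : ℂ_[p]) : z ∈ 𝓞_ℂ_[p] ↔ ‖z‖ ≤ 1 := by
  rw [PadicComplex.norm_eq_norm p z]
  change Valued.v z ≤ 1 ↔ _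
  exact (Valued.toNormedField.norm_le_one_iff (L := ℂ_[p]) (Γ₀ := NNReal) (x := z)).symm

/-- The residue field of the ring of integers of `ℂ_p`, an algebraic closure of `𝔽_p`. -/
abbrev ResField : Type := IsLocalRing.ResidueField 𝓞_ℂ_[p]

/-- The inclusion of the polynomials with integral coefficients into all polynomials. -/
abbrev inclPoly :
    MvPolynomial (Fin (n + 1)) 𝓞_ℂ_[p] →+* MvPolynomial (Fin (n + 1)) ℂ_[p] :=
  MvPolynomial.map (algebraMap 𝓞_ℂ_[p] ℂ_[p])

/-- Reduction of the coefficients of a polynomial modulo the maximal ideal. -/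
abbrev reducePoly :
    MvPolynomial (Fin (n + 1)) 𝓞_ℂ_[p] →+* MvPolynomial (Fin (n + 1)) (ResField p) :=
  MvPolynomial.map (IsLocalRing.residue 𝓞_ℂ_[p])

variable {p}

/-- The ideal `J̄`: the reduction of the ideal `J` of all polynomials with integral coefficients
in `I(C)`. It defines the reduced curve `C̄`. -/
def ProjectiveCurve.reducedIdeal (C : ProjectiveCurve ℂ_[p] n) :
    Ideal (MvPolynomial (Fin (n + 1)) (ResField p)) :=
  (C.ideal.comap (inclPoly p)).map (reducePoly p)

/-- The curve has good reduction: the Jacobian criterion holds at every point of the zero locus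
of `J̄`. -/
def ProjectiveCurve.HasGoodReduction (C : ProjectiveCurve ℂ_[p] n) : Prop :=
  IsNonsingular C.reducedIdeal

/-- The morphism has good reduction: at every point `[X̄]` of `C̄` it has a representation by forms
`G_0, …, G_n` of the same degree with integral coefficients such that `G_0(X̄), …, G_n(X̄)` do not
all vanish in the residue field. -/
def SelfMorphism.HasGoodReduction {C : ProjectiveCurve ℂ_[p] n} (φ : SelfMorphism C) : Prop :=
  ∀ X : Fin (n + 1) → ResField p, X ≠ 0 →
    (∀ f ∈ C.reducedIdeal, MvPolynomial.eval X f = 0) →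
    ∃ G : Fin (n + 1) → MvPolynomial (Fin (n + 1)) 𝓞_ℂ_[p],
      IsFormTuple G ∧
      (∀ i j, φ.form i * inclPoly p (G j) - φ.form j * inclPoly p (G i) ∈ C.ideal) ∧
      ∃ i, MvPolynomial.eval X (reducePoly p (G i)) ≠ 0

end Reduction

end CurveDynamics

end

/-! If a disc `Δ(x, y) < r` with `r < 1` contains a periodic point, it can be recentred there,
because `Δ` is ultrametric. Write `x` for the new centre, `m` for a period of it and `f = φ^m`. The
proof shows that one iterate `φ^N`, `N ≠ 0`, fixes every periodic point in the disc, and that such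
an iterate has only finitely many fixed points on the whole curve.

Good reduction makes the disc one-dimensional. Nakayama's lemma and the Jacobian criterion on the
reduced curve yield an affine coordinate `t`, zero at `x`, such that each regular function is `h =
h(x) + t h'` with `h'` regular (`exists_parameter`). Good reduction of `φ` makes `f` a self-map of
the disc that preserves the ring of regular functions
(`SelfMorphism.HasGoodReduction.exists_map_iterate`). So `t ∘ f = c t + t² h₂` with `|c| ≤ 1`.

If `|c| < 1`, then `f` contracts towards `x`, the only periodic point. If `|c| = 1`, some `c^j` is
congruent to `1`, since the residue field is algebraic over a finite field; hence `f^j` moves `t` by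
a function of Gauss norm at most `r δ` with `δ < 1`. Let `D h = h ∘ f - h`, now for this iterate.
Expanding `(1 + D)^p` shows that `p`-th powers shrink `δ`, so `δ < 1/2` after finitely many. Then
the Newton expansion of `t ∘ f^n` is dominated by its linear term `n D t`, because `|binom(n, k)| ≤
|n| k`, and periodic points are fixed (`apply_eq_of_isPeriodicPt`, `exists_iterate_eq_of_taylor`).

Globally, infinitely many fixed points of `φ^N` would force `φ^N` to be the identity as a rational
map, since a form outside `I(C)` has finitely many zeros on `C`. Then `K = φ^*(K)`, against degree
greater than one (`SelfMorphism.finite_fixedPoints_iterate`). -/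

noncomputable section

namespace CurveDynamics

set_option linter.unusedSectionVars false

/-! ### Ultrametric inequalities and Gauss norms of polynomials. -/

section Ultrametric

variable {K : Type*} [NormedField K] [IsUltrametricDist K]

theorem norm_sub_le_max (a b : K) : ‖a - b‖ ≤ max ‖a‖ ‖b‖ := by
  have := IsUltrametricDist.norm_add_le_max a (-b)
  rwa [← sub_eq_add_neg, norm_neg] at this

theorem norm_eq_of_norm_sub_lt {a b : K} (h : ‖a - b‖ < ‖a‖) : ‖b‖ = ‖a‖ := by
  rw [sub_eq_add_neg] at h
  have := IsUltrametricDist.norm_eq_of_add_norm_lt_max (h.trans_le (le_max_left _ ‖-b‖))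
  rw [this, norm_neg]

end Ultrametric

section GaussBound

variable {K : Type*} [NormedField K] [IsUltrametricDist K]

/-- The Gauss norm of radius `r` of the polynomial `q` is at most `M`. -/
def GaussLE (r M : ℝ) (q : Polynomial K) : Prop := ∀ k, ‖q.coeff k‖ * r ^ k ≤ M

namespace GaussLE

variable {r M M' : ℝ} {q q' P Q : Polynomial K}

theorem mono (h : GaussLE r M q) (hM : M ≤ M') : GaussLE r M' q := fun k => (h k).trans hM

theorem nonneg (h : GaussLE r M q) (hr : 0 ≤ r) : 0 ≤ M :=
  (mul_nonneg (norm_nonneg _) (pow_nonneg hr _)).trans (h 0)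

theorem zero (hM : 0 ≤ M) : GaussLE r M (0 : Polynomial K) := fun k => by simpa using hM

theorem C {c : K} (hc : ‖c‖ ≤ M) : GaussLE r M (Polynomial.C c) := by
  intro k
  rcases k with _ | k
  · simpa using hc
  · simpa [Polynomial.coeff_C] using (norm_nonneg _).trans hc

theorem X (hr : 0 ≤ r) : GaussLE r r (Polynomial.X : Polynomial K) := by
  intro k
  rw [Polynomial.coeff_X]
  split_ifs with h
  · simp [← h]
  · simpa using hr

theorem add (hr : 0 ≤ r) (h : GaussLE r M q) (h' : GaussLE r M q') : GaussLE r M (q + q') := by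
  intro k
  rw [Polynomial.coeff_add]
  calc _ ≤ max ‖q.coeff k‖ ‖q'.coeff k‖ * r ^ k := by
        gcongr
        exact IsUltrametricDist.norm_add_le_max _ _
    _ ≤ M := by
        rcases max_choice ‖q.coeff k‖ ‖q'.coeff k‖ with e | e <;> rw [e]
        exacts [h k, h' k]

theorem sum {ι : Type*} (s : Finset ι) (f : ι → Polynomial K) (hr : 0 ≤ r) (hM : 0 ≤ M)
    (h : ∀ i ∈ s, GaussLE r M (f i)) : GaussLE r M (∑ i ∈ s, f i) :=
  Finset.sum_induction _ (GaussLE r M) (fun _ _ => add hr) (zero hM) h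

theorem mul (hr : 0 < r) (h : GaussLE r M q) (h' : GaussLE r M' q') :
    GaussLE r (M * M') (q * q') := by
  intro k
  rw [Polynomial.coeff_mul, ← le_div_iff₀ (pow_pos hr k)]
  refine IsUltrametricDist.norm_sum_le_of_forall_le_of_nonneg
    (div_nonneg (mul_nonneg (h.nonneg hr.le) (h'.nonneg hr.le)) (pow_pos hr k).le) ?_
  rintro ⟨i, j⟩ hij
  rw [Finset.HasAntidiagonal.mem_antidiagonal] at hij
  simp only at hij ⊢
  rw [le_div_iff₀ (pow_pos hr k), ← hij, pow_add, norm_mul]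
  calc _ = (‖q.coeff i‖ * r ^ i) * (‖q'.coeff j‖ * r ^ j) := by ring
    _ ≤ M * M' := mul_le_mul (h i) (h' j) (by positivity) (h.nonneg hr.le)

theorem pow (hr : 0 < r) (h : GaussLE r r P) (k : ℕ) : GaussLE r (r ^ k) (P ^ k) := by
  induction k with
  | zero => simpa using C (r := r) (c := (1 : K)) (M := 1) (by simp)
  | succ k ih =>
    rw [pow_succ, pow_succ]
    exact ih.mul hr h

/-- Telescoping `P ^ k - Q ^ k`: each summand has one factor `P - Q` and `k - 1` factors of Gauss
norm at most `r`, and the ultrametric inequality loses nothing in the sum. -/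
theorem pow_sub_pow {δ : ℝ} (hr : 0 < r) (hP : GaussLE r r P) (hQ : GaussLE r r Q)
    (h : GaussLE r (r * δ) (P - Q)) (k : ℕ) : GaussLE r (r ^ k * δ) (P ^ k - Q ^ k) := by
  have hδ : 0 ≤ δ := nonneg_of_mul_nonneg_right (h.nonneg hr.le) hr
  induction k with
  | zero => simpa using zero hδ
  | succ k ih =>
    have e : P ^ (k + 1) - Q ^ (k + 1) = P ^ k * (P - Q) + (P ^ k - Q ^ k) * Q := by ring
    rw [e]
    refine add hr.le (((hP.pow hr k).mul hr h).mono (le_of_eq ?_))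
      ((ih.mul hr hQ).mono (le_of_eq ?_)) <;> ring

theorem comp (hr : 0 < r) (h : GaussLE r M q) (hP : GaussLE r r P) : GaussLE r M (q.comp P) := by
  rw [Polynomial.comp, Polynomial.eval₂_eq_sum_range]
  refine sum _ _ hr.le (h.nonneg hr.le) fun k _ => ?_
  exact ((C le_rfl).mul hr (hP.pow hr k)).mono (h k)

theorem comp_sub_comp {δ : ℝ} (hr : 0 < r) (h : GaussLE r M q) (hP : GaussLE r r P)
    (hQ : GaussLE r r Q) (hPQ : GaussLE r (r * δ) (P - Q)) :
    GaussLE r (M * δ) (q.comp P - q.comp Q) := by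
  have hδ : 0 ≤ δ := nonneg_of_mul_nonneg_right (hPQ.nonneg hr.le) hr
  rw [Polynomial.comp, Polynomial.comp, Polynomial.eval₂_eq_sum_range,
    Polynomial.eval₂_eq_sum_range, ← Finset.sum_sub_distrib]
  refine sum _ _ hr.le (mul_nonneg (h.nonneg hr.le) hδ) fun k _ => ?_
  rw [← mul_sub]
  refine ((C le_rfl).mul hr (hP.pow_sub_pow hr hQ hPQ k)).mono ?_
  rw [← mul_assoc]
  exact mul_le_mul_of_nonneg_right (h k) hδ

theorem norm_eval_le (hr : 0 < r) (h : GaussLE r M q) {z : K} (hz : ‖z‖ ≤ r) :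
    ‖q.eval z‖ ≤ M := by
  -- Evaluation at `z` is composition with the constant polynomial `z`, read off in degree zero.
  have := h.comp hr (C hz) 0
  simpa using this

theorem norm_eval_sub_eval_le (hr : 0 < r) (h : GaussLE r M q) {z w : K} (hz : ‖z‖ ≤ r)
    (hw : ‖w‖ ≤ r) : ‖q.eval z - q.eval w‖ ≤ M / r * ‖z - w‖ := by
  have := h.comp_sub_comp hr (C hz) (C hw) (δ := ‖z - w‖ / r)
    (by rw [← Polynomial.C_sub]; exact C (by rw [mul_div_cancel₀ _ hr.ne'])) 0
  have e : M * (‖z - w‖ / r) = M / r * ‖z - w‖ := by ring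
  simpa [e] using this

end GaussLE

end GaussBound

/-! ### Uniform limits of polynomials in a parameter, and the difference operator. -/

section Approx

variable {K α : Type*} [NormedField K] [IsUltrametricDist K]

/-- The functions that are, on the set `S`, uniform limits of polynomials in `t` whose Gauss norm
of radius `r` is at most `M`. -/
def Approx (r : ℝ) (S : Set α) (t : α → K) (M : ℝ) (h : α → K) : Prop :=
  ∀ ε > 0, ∃ q : Polynomial K, GaussLE r M q ∧ ∀ s ∈ S, ‖h s - q.eval (t s)‖ ≤ ε

namespace Approx

variable {r M M' δ : ℝ} {S : Set α} {t h h' : α → K}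

theorem mono (H : Approx r S t M h) (hM : M ≤ M') : Approx r S t M' h := fun ε hε =>
  let ⟨q, hq, hq'⟩ := H ε hε
  ⟨q, hq.mono hM, hq'⟩

theorem of_polynomial {q : Polynomial K} (hq : GaussLE r M q) (H : ∀ s ∈ S, h s = q.eval (t s)) :
    Approx r S t M h := fun ε hε => ⟨q, hq, fun s hs => by simp [H s hs, hε.le]⟩

theorem add (hr : 0 ≤ r) (H : Approx r S t M h) (H' : Approx r S t M h') :
    Approx r S t M (fun s => h s + h' s) := by
  intro ε hε
  obtain ⟨q, hq, hq'⟩ := H ε hε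
  obtain ⟨u, hu, hu'⟩ := H' ε hε
  refine ⟨q + u, hq.add hr hu, fun s hs => ?_⟩
  rw [Polynomial.eval_add, add_sub_add_comm]
  exact (IsUltrametricDist.norm_add_le_max _ _).trans (max_le (hq' s hs) (hu' s hs))

theorem const_mul (hr : 0 < r) (c : K) (H : Approx r S t M h) :
    Approx r S t (‖c‖ * M) (fun s => c * h s) := by
  intro ε hε
  obtain ⟨q, hq, hq'⟩ := H (ε / (‖c‖ + 1)) (by positivity)
  refine ⟨Polynomial.C c * q, (GaussLE.C le_rfl).mul hr hq, fun s hs => ?_⟩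
  rw [Polynomial.eval_mul, Polynomial.eval_C, ← mul_sub, norm_mul]
  have h1 := hq' s hs
  rw [le_div_iff₀ (by positivity)] at h1
  nlinarith [norm_nonneg (h s - Polynomial.eval (t s) q)]

theorem sum {ι : Type*} (I : Finset ι) (u : ι → α → K) (hr : 0 ≤ r) (hM : 0 ≤ M)
    (H : ∀ i ∈ I, Approx r S t M (u i)) : Approx r S t M (fun s => ∑ i ∈ I, u i s) := by
  classical
  induction I using Finset.induction_on with
  | empty => exact of_polynomial (GaussLE.zero hM) (by simp)
  | insert i I hi ih =>
    simp only [Finset.sum_insert hi]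
    exact (H i (by simp)).add hr (ih fun j hj => H j (by simp [hj]))

theorem norm_sub_le (hr : 0 < r) (ht : ∀ s ∈ S, ‖t s‖ ≤ r) (H : Approx r S t M h) {s s' : α}
    (hs : s ∈ S) (hs' : s' ∈ S) : ‖h s - h s'‖ ≤ M / r * ‖t s - t s'‖ := by
  refine le_of_forall_pos_le_add fun ε hε => ?_
  obtain ⟨q, hq, hq'⟩ := H (ε / 2) (by positivity)
  have h1 := hq.norm_eval_sub_eval_le hr (ht s hs) (ht s' hs')
  have e : h s - h s' = (h s - q.eval (t s)) - (h s' - q.eval (t s')) +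
    (q.eval (t s) - q.eval (t s')) := by ring
  rw [e]
  have h2 := norm_add_le ((h s - q.eval (t s)) - (h s' - q.eval (t s')))
    (q.eval (t s) - q.eval (t s'))
  have h3 := _root_.norm_sub_le (h s - q.eval (t s)) (h s' - q.eval (t s'))
  linarith [hq' s hs, hq' s' hs']

/-- If `f` moves the parameter `t` by a function of Gauss norm at most `r δ`, then the difference
operator `h ↦ h ∘ f - h` contracts by the factor `δ`. -/
theorem comp_sub {f : α → α} (hr : 0 < r) (ht : ∀ s ∈ S, ‖t s‖ ≤ r) (hf : Set.MapsTo f S S)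
    (hδ : δ ≤ 1) (hft : Approx r S t (r * δ) fun s => t (f s) - t s) (H : Approx r S t M h) :
    Approx r S t (M * δ) fun s => h (f s) - h s := by
  intro ε hε
  obtain ⟨q, hq, hq'⟩ := H ε hε
  have hM := hq.nonneg hr.le
  -- On the disc `q` is Lipschitz with constant `M / r`, so this tolerance costs at most `ε`; `M +
  -- r` in place of `M` allows for `M = 0`.
  obtain ⟨u, hu, hu'⟩ := hft (ε * r / (M + r)) (by positivity)
  have hu1 : GaussLE r r (Polynomial.X + u) :=
    (GaussLE.X hr.le).add hr.le (hu.mono (by nlinarith))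
  refine ⟨q.comp (Polynomial.X + u) - q.comp Polynomial.X,
    hq.comp_sub_comp hr hu1 (GaussLE.X hr.le) (by simpa using hu), fun s hs => ?_⟩
  have e : h (f s) - h s - (q.comp (Polynomial.X + u) - q.comp Polynomial.X).eval (t s) =
      (h (f s) - q.eval (t (f s))) + (-(h s - q.eval (t s)) +
        (q.eval (t (f s)) - q.eval (t s + u.eval (t s)))) := by
    simp only [Polynomial.eval_sub, Polynomial.eval_comp, Polynomial.eval_add, Polynomial.eval_X]
    ring
  rw [e]
  refine (IsUltrametricDist.norm_add_le_max _ _).trans (max_le (hq' _ (hf hs)) ?_)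
  refine (IsUltrametricDist.norm_add_le_max _ _).trans (max_le ?_ ?_)
  · rw [norm_neg]
    exact hq' s hs
  · have h1 : ‖t s + u.eval (t s)‖ ≤ r := by
      simpa using hu1.norm_eval_le hr (ht s hs)
    have h2 := hq.norm_eval_sub_eval_le hr (ht _ (hf hs)) h1
    have h3 := hu' s hs
    rw [sub_sub] at h3
    refine h2.trans ((mul_le_mul_of_nonneg_left h3 (by positivity)).trans ?_)
    have : M / r * (ε * r / (M + r)) = ε * (M / (M + r)) := by field_simp
    rw [this]
    refine mul_le_of_le_one_right hε.le ?_
    rw [div_le_one (by positivity)]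
    linarith

end Approx

/-- The difference operator `h ↦ h ∘ f - h`. -/
def compDiff (f : α → α) (h : α → K) : α → K := fun s => h (f s) - h s

/-- The binomial expansion of `(1 + D)^n`. Along the orbit of `s`, the operator `D` becomes the
forward difference of the sequence `m ↦ h (f^[m] s)`, so this is Newton's formula. -/
theorem apply_iterate_eq_sum_compDiff (f : α → α) (h : α → K) (n : ℕ) (s : α) :
    h (f^[n] s) = ∑ k ∈ Finset.range (n + 1), (n.choose k : K) * (compDiff f)^[k] h s := by
  have key : Function.Semiconj (fun (h : α → K) (m : ℕ) => h (f^[m] s)) (compDiff f)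
      (fwdDiff 1) := by
    intro h
    funext m
    simp [compDiff, fwdDiff, Function.iterate_succ_apply']
  have := shift_eq_sum_fwdDiff_iter 1 (fun m : ℕ => h (f^[m] s)) n 0
  simp only [smul_eq_mul, mul_one, zero_add, nsmul_eq_mul] at this
  rw [this]
  refine Finset.sum_congr rfl fun k _ => ?_
  have h2 := congrFun ((key.iterate_right k) h) 0
  rw [← h2]
  rfl

theorem Approx.compDiff_iterate {r δ : ℝ} {S : Set α} {t : α → K} {f : α → α} (hr : 0 < r)
    (ht : ∀ s ∈ S, ‖t s‖ ≤ r) (hf : Set.MapsTo f S S)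
    (hδ : δ ≤ 1) (hft : Approx r S t (r * δ) fun s => t (f s) - t s) (k : ℕ) :
    Approx r S t (r * δ ^ k) ((compDiff f)^[k] t) := by
  induction k with
  | zero => exact of_polynomial (by simpa using GaussLE.X hr.le) (by simp)
  | succ k ih =>
    rw [Function.iterate_succ_apply', pow_succ, ← mul_assoc]
    exact comp_sub hr ht hf hδ hft ih

end Approx

/-! ### Binomial coefficients and residual roots of unity in `ℂ_[p]`. -/

section Padic

variable (p : ℕ) [Fact p.Prime]

theorem norm_natCast_eq (j : ℕ) : ‖(j : ℂ_[p])‖ = ‖(j : ℚ_[p])‖ := by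
  rw [← PadicComplex.norm_extends' p (j : ℚ_[p])]
  congr 1
  simp

theorem norm_natCast_le_one (j : ℕ) : ‖(j : ℂ_[p])‖ ≤ 1 := by
  rw [norm_natCast_eq]
  exact_mod_cast Padic.norm_int_le_one (p := p) (j : ℤ)

theorem norm_prime_lt_one : ‖(p : ℂ_[p])‖ < 1 := by
  rw [norm_natCast_eq]
  exact Padic.norm_p_lt_one

theorem one_le_mul_norm_natCast {j : ℕ} (hj : j ≠ 0) : 1 ≤ (j : ℝ) * ‖(j : ℂ_[p])‖ := by
  have hp : 0 < p := (Fact.out : p.Prime).pos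
  rw [norm_natCast_eq, Padic.norm_eq_zpow_neg_valuation (by exact_mod_cast hj),
    Padic.valuation_natCast, zpow_neg, zpow_natCast, ← div_eq_mul_inv,
    one_le_div (by positivity)]
  exact_mod_cast Nat.le_of_dvd (Nat.pos_of_ne_zero hj) pow_padicValNat_dvd

/-- From `j * binom(n, j) = n * binom(n - 1, j - 1)` and `1 / |j| ≤ j`. The factor `|n|` is what
allows a comparison with the linear term of Newton's formula. -/
theorem norm_choose_le (n j : ℕ) (hj : j ≠ 0) :
    ‖(n.choose j : ℂ_[p])‖ ≤ ‖(n : ℂ_[p])‖ * j := by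
  obtain ⟨i, rfl⟩ := Nat.exists_eq_succ_of_ne_zero hj
  rcases n with _ | m
  · simp
  have h : ((m + 1 : ℕ) : ℂ_[p]) * (m.choose i : ℂ_[p]) =
      ((m + 1).choose (i + 1) : ℂ_[p]) * ((i + 1 : ℕ) : ℂ_[p]) := by
    exact_mod_cast Nat.add_one_mul_choose_eq m i
  have h1 := one_le_mul_norm_natCast p hj
  have h2 := congrArg norm h
  rw [norm_mul, norm_mul] at h2
  calc ‖((m + 1).choose (i + 1) : ℂ_[p])‖
      ≤ ‖((m + 1).choose (i + 1) : ℂ_[p])‖ * (((i + 1 : ℕ) : ℝ) * ‖((i + 1 : ℕ) : ℂ_[p])‖) :=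
        le_mul_of_one_le_right (norm_nonneg _) h1
    _ = ‖((m + 1 : ℕ) : ℂ_[p])‖ * ‖(m.choose i : ℂ_[p])‖ * ((i + 1 : ℕ) : ℝ) := by
        rw [h2]; ring
    _ ≤ ‖((m + 1 : ℕ) : ℂ_[p])‖ * 1 * ((i + 1 : ℕ) : ℝ) := by
        gcongr
        exact norm_natCast_le_one p _
    _ = _ := by rw [mul_one]

/-- The powers of `a` stay in the unit ball of the finite extension `ℚ_p(a)`, which is compact.
Hence two of them are at distance less than one, and their quotient is the desired power. -/
theorem exists_norm_pow_sub_one_lt_of_algebraic (a : PadicAlgCl p) (ha : ‖a‖ = 1) :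
    ∃ j ≠ 0, ‖a ^ j - 1‖ < 1 := by
  let E := IntermediateField.adjoin ℚ_[p] {a}
  have : FiniteDimensional ℚ_[p] E :=
    IntermediateField.adjoin.finiteDimensional (Algebra.IsIntegral.isIntegral a)
  have : ProperSpace E.toSubalgebra.toSubmodule :=
    have : FiniteDimensional ℚ_[p] E.toSubalgebra.toSubmodule := this
    FiniteDimensional.proper ℚ_[p] _
  have haE : a ∈ E := IntermediateField.mem_adjoin_simple_self _ _
  let u : ℕ → E.toSubalgebra.toSubmodule := fun k => ⟨a ^ k, pow_mem haE k⟩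
  obtain ⟨b, -, ψ, hψ, hb⟩ := tendsto_subseq_of_bounded
    (Metric.isBounded_closedBall (x := 0) (r := 1))
    (x := u) (fun k => by
      rw [mem_closedBall_zero_iff]
      change ‖a ^ k‖ ≤ 1
      rw [norm_pow, ha, one_pow])
  obtain ⟨N, hN⟩ := Metric.cauchySeq_iff.mp hb.cauchySeq 1 one_pos
  have h1 := hN (N + 1) (by omega) N le_rfl
  have h2 : ψ N < ψ (N + 1) := hψ (by omega)
  have h3 : ‖a ^ ψ (N + 1) - a ^ ψ N‖ < 1 := by
    rw [dist_eq_norm] at h1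
    exact h1
  refine ⟨ψ (N + 1) - ψ N, by omega, ?_⟩
  have h4 : a ^ ψ (N + 1) - a ^ ψ N = a ^ ψ N * (a ^ (ψ (N + 1) - ψ N) - 1) := by
    rw [mul_sub, ← pow_add, Nat.add_sub_of_le h2.le, mul_one]
  rw [h4, norm_mul, norm_pow, ha, one_pow, one_mul] at h3
  exact h3

/-- The residue field of `ℂ_p` is an algebraic extension of a finite field, so that every unit is a
root of unity modulo the maximal ideal. -/
theorem exists_norm_pow_sub_one_lt (c : ℂ_[p]) (hc : ‖c‖ = 1) : ∃ j ≠ 0, ‖c ^ j - 1‖ < 1 := by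
  -- Algebraic elements are dense, so the residue class of `c` contains one.
  obtain ⟨a, ha⟩ : ∃ a : PadicAlgCl p, ‖c - (a : ℂ_[p])‖ < 1 := by
    have := UniformSpace.Completion.denseRange_coe (α := PadicAlgCl p)
    obtain ⟨a, ha⟩ := this.exists_dist_lt c one_pos
    exact ⟨a, by rwa [dist_eq_norm] at ha⟩
  have ha1 : ‖(a : ℂ_[p])‖ = 1 := by
    rw [← hc]
    exact norm_eq_of_norm_sub_lt (by rwa [hc])
  obtain ⟨j, hj, hj'⟩ := exists_norm_pow_sub_one_lt_of_algebraic p a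
    (by rwa [PadicComplex.norm_extends] at ha1)
  refine ⟨j, hj, ?_⟩
  have e : c ^ j - 1 = (c ^ j - (a : ℂ_[p]) ^ j) + ((a : ℂ_[p]) ^ j - 1) := by ring
  rw [e]
  refine (IsUltrametricDist.norm_add_le_max _ _).trans_lt (max_lt ?_ ?_)
  · rw [← (Commute.all c _).geom_sum₂_mul, norm_mul]
    refine lt_of_le_of_lt (mul_le_of_le_one_left (norm_nonneg _) ?_) ha
    refine IsUltrametricDist.norm_sum_le_of_forall_le_of_nonneg zero_le_one fun i _ => ?_
    rw [norm_mul, norm_pow, norm_pow, hc, ha1]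
    simp
  · have : (a : ℂ_[p]) ^ j - 1 = ((a ^ j - 1 : PadicAlgCl p) : ℂ_[p]) := by
      simp only [PadicComplex.coe_eq, map_sub, map_pow, map_one]
    rw [this, PadicComplex.norm_extends]
    exact hj'

end Padic

/-! ### Periodic points on a disc with one parameter. -/

section LocalDynamics

variable {p : ℕ} [Fact p.Prime] {α : Type*} {r δ : ℝ} {S : Set α} {t : α → ℂ_[p]} {f : α → α}

/-- If `f` moves `t` by a sufficiently small function, then the periodic points of `f` are
fixed points. -/
theorem apply_eq_of_isPeriodicPt (hr : 0 < r) (ht : ∀ s ∈ S, ‖t s‖ ≤ r) (hf : Set.MapsTo f S S)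
    (hδ0 : 0 ≤ δ) (hδ : δ < 1 / 2) (hft : Approx r S t (r * δ) fun s => t (f s) - t s)
    {s : α} (hs : s ∈ S) {n : ℕ} (hn : n ≠ 0) (hper : f^[n] s = s) : t (f s) = t s := by
  by_contra hne
  have hg : 0 < ‖t (f s) - t s‖ := norm_pos_iff.mpr (sub_ne_zero.mpr hne)
  have hn0 : 0 < ‖(n : ℂ_[p])‖ := norm_pos_iff.mpr (by exact_mod_cast hn)
  -- `D^k t` has Gauss norm at most `r δ^k`, hence is `δ^k`-Lipschitz in `t`; this is applied to `f
  -- s` and `s`.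
  have hD : ∀ k, ‖(compDiff f)^[k + 1] t s‖ ≤ δ ^ k * ‖t (f s) - t s‖ := by
    intro k
    rw [Function.iterate_succ_apply']
    have := (Approx.compDiff_iterate hr ht hf (by linarith) hft k).norm_sub_le hr ht (hf hs) hs
    rwa [mul_div_cancel_left₀ _ hr.ne'] at this
  have hsum := apply_iterate_eq_sum_compDiff f t n s
  rw [hper, Finset.sum_range_succ'] at hsum
  obtain ⟨m, rfl⟩ := Nat.exists_eq_succ_of_ne_zero hn
  rw [Finset.sum_range_succ'] at hsum
  simp only [Nat.choose_zero_right, Nat.cast_one, one_mul, Function.iterate_zero, id, zero_add,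
    Nat.choose_one_right, Function.iterate_one] at hsum
  -- As `f^n s = s`, the constant term of Newton's formula cancels and the linear term balances all
  -- higher ones.
  have h0 : ((m + 1 : ℕ) : ℂ_[p]) * (t (f s) - t s) = -∑ k ∈ Finset.range m,
      ((m + 1).choose (k + 1 + 1) : ℂ_[p]) * (compDiff f)^[k + 1 + 1] t s := by
    have e : compDiff f t s = t (f s) - t s := rfl
    rw [e] at hsum
    rw [eq_neg_iff_add_eq_zero, add_comm]
    exact add_right_cancel (hsum.symm.trans (zero_add _).symm)
  have h1 : ‖∑ k ∈ Finset.range m, ((m + 1).choose (k + 1 + 1) : ℂ_[p]) *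
      (compDiff f)^[k + 1 + 1] t s‖ < ‖((m + 1 : ℕ) : ℂ_[p])‖ * ‖t (f s) - t s‖ := by
    rcases (Finset.range m).eq_empty_or_nonempty with he | he
    · rw [he]
      simp only [Finset.sum_empty, norm_zero]
      positivity
    obtain ⟨k, -, hk⟩ := IsUltrametricDist.exists_norm_finsetSum_le_of_nonempty he
      fun k => ((m + 1).choose (k + 1 + 1) : ℂ_[p]) * (compDiff f)^[k + 1 + 1] t s
    refine hk.trans_lt ?_
    rw [norm_mul]
    -- The threshold `δ < 1/2` is used here, through `k + 2 ≤ 2^(k + 1)`.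
    have hsmall : ((k + 1 + 1 : ℕ) : ℝ) * δ ^ (k + 1) < 1 := by
      have h2 : ((k + 1 + 1 : ℕ) : ℝ) ≤ 2 ^ (k + 1) := by exact_mod_cast Nat.lt_two_pow_self
      have h3 : δ ^ (k + 1) < (1 / 2) ^ (k + 1) := pow_lt_pow_left₀ hδ hδ0 (by omega)
      calc _ ≤ 2 ^ (k + 1) * δ ^ (k + 1) := by gcongr
        _ < 2 ^ (k + 1) * (1 / 2) ^ (k + 1) := by gcongr
        _ = 1 := by rw [← mul_pow]; norm_num
    calc _ ≤ (‖((m + 1 : ℕ) : ℂ_[p])‖ * ((k + 1 + 1 : ℕ) : ℝ)) *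
          (δ ^ (k + 1) * ‖t (f s) - t s‖) :=
        mul_le_mul (norm_choose_le p _ _ (by omega)) (hD _) (norm_nonneg _) (by positivity)
      _ = (‖((m + 1 : ℕ) : ℂ_[p])‖ * ‖t (f s) - t s‖) *
          (((k + 1 + 1 : ℕ) : ℝ) * δ ^ (k + 1)) := by ring
      _ < _ := mul_lt_of_lt_one_right (by positivity) hsmall
  rw [← norm_neg, ← h0, norm_mul] at h1
  exact lt_irrefl _ h1

/-- In `(1 + D)^p - 1` the terms of order `0 < k < p` gain a factor `|p|` from the binomial
coefficient, and the term of order `p` gains `δ^(p - 1) ≤ δ`. -/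
theorem Approx.iterate_prime (hr : 0 < r) (ht : ∀ s ∈ S, ‖t s‖ ≤ r) (hf : Set.MapsTo f S S)
    (hδ0 : 0 ≤ δ) (hδ : δ ≤ 1) (hft : Approx r S t (r * δ) fun s => t (f s) - t s) :
    Approx r S t (r * (max ‖(p : ℂ_[p])‖ δ * δ)) fun s => t (f^[p] s) - t s := by
  have hp := (Fact.out : p.Prime)
  have e : (fun s => t (f^[p] s) - t s) = fun s => ∑ k ∈ Finset.range p,
      (p.choose (k + 1) : ℂ_[p]) * (compDiff f)^[k + 1] t s := by
    funext s
    rw [apply_iterate_eq_sum_compDiff f t p s, Finset.sum_range_succ']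
    simp
  rw [e]
  refine Approx.sum _ _ hr.le (by positivity) fun k hk => ?_
  rw [Finset.mem_range] at hk
  refine ((Approx.compDiff_iterate hr ht hf hδ hft (k + 1)).const_mul hr _).mono ?_
  rw [mul_left_comm]
  refine mul_le_mul_of_nonneg_left ?_ hr.le
  rw [pow_succ, ← mul_assoc]
  refine mul_le_mul_of_nonneg_right ?_ hδ0
  rcases eq_or_ne (k + 1) p with hkp | hkp
  · refine le_trans ?_ (le_max_right _ _)
    have hk1 : k ≠ 0 := by have := hp.two_le; omega
    calc _ ≤ 1 * δ ^ k := by gcongr; exact norm_natCast_le_one p _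
      _ ≤ δ := by rw [one_mul]; exact pow_le_of_le_one hδ0 hδ hk1
  · refine le_trans ?_ (le_max_left _ _)
    obtain ⟨c, hc⟩ := hp.dvd_choose_self (k := k + 1) (by omega) (by omega)
    rw [hc, Nat.cast_mul, norm_mul, mul_assoc]
    refine mul_le_of_le_one_right (norm_nonneg _) ?_
    exact mul_le_one₀ (norm_natCast_le_one p c) (by positivity) (pow_le_one₀ hδ0 hδ)

theorem Approx.iterate_prime_pow (hr : 0 < r) (ht : ∀ s ∈ S, ‖t s‖ ≤ r) (hf : Set.MapsTo f S S)
    (hδ0 : 0 ≤ δ) (hδ : δ ≤ 1) (hft : Approx r S t (r * δ) fun s => t (f s) - t s) (N : ℕ) :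
    Approx r S t (r * (max ‖(p : ℂ_[p])‖ δ ^ N * δ)) fun s => t (f^[p ^ N] s) - t s := by
  have hρ : max ‖(p : ℂ_[p])‖ δ ≤ 1 := max_le (norm_prime_lt_one p).le hδ
  have hρ0 : 0 ≤ max ‖(p : ℂ_[p])‖ δ := hδ0.trans (le_max_right _ _)
  induction N with
  | zero => simpa using hft
  | succ N ih =>
    have h1 : max ‖(p : ℂ_[p])‖ δ ^ N * δ ≤ δ :=
      mul_le_of_le_one_left hδ0 (pow_le_one₀ hρ0 hρ)
    have h2 := Approx.iterate_prime hr ht (hf.iterate _) (by positivity) (h1.trans hδ) ih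
    simp only [← Function.iterate_mul, ← pow_succ] at h2
    refine h2.mono (mul_le_mul_of_nonneg_left ?_ hr.le)
    rw [pow_succ', mul_assoc]
    -- The displacement only decreases, so the initial ratio `max |p| δ` bounds every later one.
    exact mul_le_mul_of_nonneg_right (max_le_max le_rfl h1) (by positivity)

/-- A self-map that is congruent to the identity on an open residue disc has, on each smaller
closed disc, only periodic points whose period divides a fixed power of `p`. -/
theorem exists_iterate_apply_eq (hr : 0 < r) (ht : ∀ s ∈ S, ‖t s‖ ≤ r) (hf : Set.MapsTo f S S)
    (hδ0 : 0 ≤ δ) (hδ : δ < 1) (hft : Approx r S t (r * δ) fun s => t (f s) - t s) :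
    ∃ N ≠ 0, ∀ s ∈ S, s ∈ Function.periodicPts f → t (f^[N] s) = t s := by
  have hρ : max ‖(p : ℂ_[p])‖ δ < 1 := max_lt (norm_prime_lt_one p) hδ
  have hρ0 : 0 ≤ max ‖(p : ℂ_[p])‖ δ := hδ0.trans (le_max_right _ _)
  obtain ⟨N, hN⟩ := exists_pow_lt_of_lt_one (show (0 : ℝ) < 1 / 2 by norm_num) hρ
  refine ⟨p ^ N, pow_ne_zero _ (Fact.out : p.Prime).ne_zero, fun s hs hper => ?_⟩
  obtain ⟨n, hn, hper⟩ := hper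
  refine apply_eq_of_isPeriodicPt hr ht (hf.iterate _) (by positivity) ?_
    (Approx.iterate_prime_pow hr ht hf hδ0 hδ.le hft N) hs hn.ne' ?_
  · nlinarith [pow_nonneg hρ0 N]
  · rw [← Function.iterate_mul, mul_comm, Function.iterate_mul]
    exact Function.IsFixedPt.iterate hper _

/-- The local form of the finiteness theorem: `R` is a ring of functions with values in the closed
unit disc in which every function has a Taylor expansion in the parameter `t` at the fixed
point `x` of `f`. -/
theorem exists_iterate_eq_of_taylor (hr : 0 < r) (hr1 : r < 1) (ht : ∀ s, ‖t s‖ ≤ r)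
    (R : Subring (α → ℂ_[p])) (hR : ∀ h ∈ R, ∀ s, ‖h s‖ ≤ 1) (x : α) (hfx : f x = x)
    (hconst : ∀ c : ℂ_[p], ‖c‖ ≤ 1 → (fun _ => c) ∈ R) (htR : t ∈ R) (htx : t x = 0)
    (htaylor : ∀ h ∈ R, ∃ h' ∈ R, ∀ s, h s = h x + t s * h' s)
    (hcomp : ∀ h ∈ R, h ∘ f ∈ R) (hsep : ∀ s s', (∀ h ∈ R, h s = h s') → s = s') :
    ∃ N ≠ 0, ∀ s ∈ Function.periodicPts f, f^[N] s = s := by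
  -- Iterating the expansion gives Taylor polynomials with integral coefficients; their remainders
  -- are at most `r^k`, which tends to zero.
  have hpoly : ∀ k, ∀ h ∈ R, ∃ q : Polynomial ℂ_[p], (∀ i, ‖q.coeff i‖ ≤ 1) ∧
      ∃ h' ∈ R, ∀ s, h s = q.eval (t s) + t s ^ k * h' s := by
    intro k
    induction k with
    | zero => exact fun h hh => ⟨0, by simp, h, hh, by simp⟩
    | succ k ih =>
      intro h hh
      obtain ⟨h₁, hh₁, e₁⟩ := htaylor h hh
      obtain ⟨q, hq, h', hh', e⟩ := ih h₁ hh₁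
      refine ⟨Polynomial.C (h x) + Polynomial.X * q, fun i => ?_, h', hh', fun s => ?_⟩
      · rcases i with _ | i
        · simpa using hR h hh x
        · simpa [Polynomial.coeff_C] using hq i
      · rw [e₁, e]
        simp only [Polynomial.eval_add, Polynomial.eval_mul, Polynomial.eval_C, Polynomial.eval_X]
        ring
  have happrox : ∀ h ∈ R, ∀ ε > 0, ∃ q : Polynomial ℂ_[p], (∀ i, ‖q.coeff i‖ ≤ 1) ∧
      ∀ s, ‖h s - q.eval (t s)‖ ≤ ε := by
    intro h hh ε hε
    obtain ⟨k, hk⟩ := exists_pow_lt_of_lt_one hε hr1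
    obtain ⟨q, hq, h', hh', e⟩ := hpoly k h hh
    refine ⟨q, hq, fun s => ?_⟩
    rw [e, add_sub_cancel_left, norm_mul, norm_pow]
    calc _ ≤ r ^ k * 1 := by gcongr; exacts [ht s, hR h' hh' s]
      _ ≤ ε := by rw [mul_one]; exact hk.le
  have htinj : ∀ s s', t s = t s' → s = s' := by
    refine fun s s' hss => hsep s s' fun h hh => ?_
    rw [← sub_eq_zero, ← norm_le_zero_iff]
    refine le_of_forall_pos_le_add fun ε hε => ?_
    obtain ⟨q, -, hq⟩ := happrox h hh ε hε
    have h1 := hq s'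
    rw [← hss] at h1
    have e : h s - h s' = (h s - q.eval (t s)) - (h s' - q.eval (t s)) := by ring
    rw [e, zero_add]
    exact (norm_sub_le_max _ _).trans (max_le (hq s) h1)
  -- Expanding twice gives `t ∘ f = t h₁` and `h₁ = c + t h₂`, where `c` is the multiplier of the
  -- fixed point.
  obtain ⟨h₁, hh₁, e₁⟩ := htaylor (t ∘ f) (hcomp t htR)
  obtain ⟨h₂, hh₂, e₂⟩ := htaylor h₁ hh₁
  have e₁' : ∀ s, t (f s) = t s * h₁ s := fun s => by
    have := e₁ s
    simpa [hfx, htx] using this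
  have hc : ‖h₁ x‖ ≤ 1 := hR _ hh₁ x
  set c := h₁ x with hcdef
  -- For `|c| < 1`, `|h₁| ≤ max |c| r < 1` on the whole disc, so orbits converge to `x` and no other
  -- point can return.
  rcases hc.lt_or_eq with hc | hc
  · refine ⟨1, one_ne_zero, fun s hs => ?_⟩
    obtain ⟨n, hn, hper⟩ := hs
    have hbd : ∀ s, ‖h₁ s‖ ≤ max ‖c‖ r := fun s => by
      rw [e₂]
      refine (IsUltrametricDist.norm_add_le_max _ _).trans (max_le_max le_rfl ?_)
      rw [norm_mul]
      calc _ ≤ r * 1 := by gcongr; exacts [ht s, hR _ hh₂ s]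
        _ = r := mul_one r
    have hρ : max ‖c‖ r < 1 := max_lt hc hr1
    have hit : ∀ k, ‖t (f^[k] s)‖ ≤ max ‖c‖ r ^ k * ‖t s‖ := by
      intro k
      induction k with
      | zero => simp
      | succ k ih =>
        rw [Function.iterate_succ_apply', e₁', norm_mul, pow_succ', mul_comm]
        rw [mul_assoc]
        exact mul_le_mul (hbd _) ih (norm_nonneg _) (hr.le.trans (le_max_right _ _))
    have h1 := hit n
    rw [hper] at h1
    have h2 : max ‖c‖ r ^ n < 1 :=
      pow_lt_one₀ (hr.le.trans (le_max_right _ _)) hρ hn.ne'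
    have h3 : t s = 0 := by
      rw [← norm_eq_zero]
      by_contra h4
      have h5 : 0 < ‖t s‖ := lt_of_le_of_ne (norm_nonneg _) (Ne.symm h4)
      nlinarith
    have h4 : s = x := htinj _ _ (h3.trans htx.symm)
    rw [h4]
    exact hfx
  · obtain ⟨j, hj, hcj⟩ := exists_norm_pow_sub_one_lt p c hc
    have hiter : ∀ j, ∃ h' ∈ R, ∀ s, t (f^[j] s) = c ^ j * t s + t s ^ 2 * h' s := by
      intro j
      induction j with
      | zero => exact ⟨0, R.zero_mem, by simp⟩
      | succ j ih =>
        obtain ⟨h', hh', e⟩ := ih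
        refine ⟨(fun _ => c ^ j) * h₂ + h₁ ^ 2 * (h' ∘ f), R.add_mem (R.mul_mem (hconst _ ?_) hh₂)
          (R.mul_mem (R.pow_mem hh₁ 2) (hcomp _ hh')), fun s => ?_⟩
        · rw [norm_pow, hc, one_pow]
        · rw [Function.iterate_succ_apply, e, e₁']
          simp only [Pi.add_apply, Pi.mul_apply, Pi.pow_apply, Function.comp_apply]
          rw [mul_pow]
          have := e₂ s
          linear_combination (c ^ j * t s) * this
    obtain ⟨h', hh', e⟩ := hiter j
    -- The displacement is `(c^j - 1) t + t² h'`: the first term has Gauss norm at most `r |c^j -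
    -- 1|`, and polynomial approximations of the second at most `r * r`.
    have hA : Approx r Set.univ t (r * max ‖c ^ j - 1‖ r) fun s => t (f^[j] s) - t s := by
      intro ε hε
      obtain ⟨q, hq, hq'⟩ := happrox h' hh' ε hε
      refine ⟨Polynomial.C (c ^ j - 1) * Polynomial.X + Polynomial.X * (Polynomial.X * q),
        GaussLE.add hr.le ?_ ?_, fun s _ => ?_⟩
      · refine ((GaussLE.C le_rfl).mul hr (GaussLE.X hr.le)).mono ?_
        rw [mul_comm]
        exact mul_le_mul_of_nonneg_left (le_max_left _ _) hr.le
      · have hq1 : GaussLE r 1 q := fun k =>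
          mul_le_one₀ (hq k) (by positivity) (pow_le_one₀ hr.le hr1.le)
        refine ((GaussLE.X hr.le).mul hr ((GaussLE.X hr.le).mul hr hq1)).mono ?_
        rw [mul_one]
        exact mul_le_mul_of_nonneg_left (le_max_right _ _) hr.le
      · have e3 : t (f^[j] s) - t s - (Polynomial.C (c ^ j - 1) * Polynomial.X +
            Polynomial.X * (Polynomial.X * q)).eval (t s) =
            t s ^ 2 * (h' s - q.eval (t s)) := by
          rw [e]
          simp only [Polynomial.eval_add, Polynomial.eval_mul, Polynomial.eval_C,
            Polynomial.eval_X]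
          ring
        rw [e3, norm_mul, norm_pow]
        refine le_trans (mul_le_of_le_one_left (norm_nonneg _) ?_) (hq' s)
        exact pow_le_one₀ (norm_nonneg _) ((ht s).trans hr1.le)
    obtain ⟨N, hN, hN'⟩ := exists_iterate_apply_eq hr (fun s _ => ht s) (Set.mapsTo_univ _ _)
      (hr.le.trans (le_max_right _ _)) (max_lt hcj hr1) hA
    refine ⟨j * N, mul_ne_zero hj hN, fun s hs => htinj _ _ ?_⟩
    rw [Function.iterate_mul]
    refine hN' s trivial ?_
    obtain ⟨n, hn, hper⟩ := hs
    exact ⟨n, hn, hper.iterate j⟩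

end LocalDynamics

/-! ### Zeros of forms on a curve and fixed points of iterates. -/

section Finiteness

variable {k : Type*} [Field k] {n : ℕ}

theorem eval_smul_of_isHomogeneous {R : Type*} [CommRing R] {P : MvPolynomial (Fin (n + 1)) R}
    {m : ℕ} (hP : P.IsHomogeneous m) (c : R) (X : Fin (n + 1) → R) :
    MvPolynomial.eval (c • X) P = c ^ m * MvPolynomial.eval X P := by
  rw [MvPolynomial.eval_eq', MvPolynomial.eval_eq', Finset.mul_sum]
  refine Finset.sum_congr rfl fun d hd => ?_
  have hd' := hP (MvPolynomial.mem_support_iff.mp hd)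
  rw [Finsupp.weight_apply, Finsupp.sum_fintype _ _ (by simp)] at hd'
  simp only [Pi.one_apply, smul_eq_mul, mul_one] at hd'
  simp only [Pi.smul_apply, smul_eq_mul, mul_pow, Finset.prod_mul_distrib,
    Finset.prod_pow_eq_pow_sum, hd']
  ring

/-- The prime ideal of all polynomials that vanish on the line spanned by `Y`. -/
def lineIdeal (Y : Fin (n + 1) → k) : Ideal (MvPolynomial (Fin (n + 1)) k) :=
  RingHom.ker (MvPolynomial.aeval fun i => Polynomial.C (Y i) * Polynomial.X :
    MvPolynomial (Fin (n + 1)) k →ₐ[k] Polynomial k)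

instance (Y : Fin (n + 1) → k) : (lineIdeal Y).IsPrime := RingHom.ker_isPrime _

theorem eval_aeval_line (Y : Fin (n + 1) → k) (f : MvPolynomial (Fin (n + 1)) k) (c : k) :
    (MvPolynomial.aeval (fun i => Polynomial.C (Y i) * Polynomial.X) f : Polynomial k).eval c =
      MvPolynomial.eval (c • Y) f := by
  induction f using MvPolynomial.induction_on with
  | C a => rw [MvPolynomial.aeval_C, MvPolynomial.eval_C, Polynomial.algebraMap_eq,
      Polynomial.eval_C]
  | add f g hf hg => simp only [map_add, Polynomial.eval_add, hf, hg]
  | mul_X f i hf =>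
    rw [map_mul, map_mul, Polynomial.eval_mul, hf, MvPolynomial.aeval_X, MvPolynomial.eval_X,
      Polynomial.eval_mul, Polynomial.eval_C, Polynomial.eval_X, Pi.smul_apply, smul_eq_mul,
      mul_comm c]

theorem mem_lineIdeal_iff [Infinite k] (Y : Fin (n + 1) → k) (f : MvPolynomial (Fin (n + 1)) k) :
    f ∈ lineIdeal Y ↔ ∀ c : k, c ≠ 0 → MvPolynomial.eval (c • Y) f = 0 := by
  rw [lineIdeal, RingHom.mem_ker]
  constructor
  · intro h c _
    rw [← eval_aeval_line, h, Polynomial.eval_zero]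
  · intro h
    -- The factor `X` takes care of `c = 0`, where the hypothesis says nothing.
    have h1 : (MvPolynomial.aeval (fun i => Polynomial.C (Y i) * Polynomial.X) f : Polynomial k) *
        Polynomial.X = 0 := by
      refine Polynomial.funext fun c => ?_
      rcases eq_or_ne c 0 with rfl | hc
      · simp
      · simp [eval_aeval_line, h c hc]
    exact (mul_eq_zero.mp h1).resolve_right Polynomial.X_ne_zero

theorem eval_zero_of_mem_lineIdeal {Y : Fin (n + 1) → k} {f : MvPolynomial (Fin (n + 1)) k}
    (hf : f ∈ lineIdeal Y) : MvPolynomial.eval 0 f = 0 := by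
  have h := eval_aeval_line Y f 0
  have hf' : (MvPolynomial.aeval (fun i => Polynomial.C (Y i) * Polynomial.X) f :
    Polynomial k) = 0 := hf
  rw [hf', zero_smul] at h
  simpa using h.symm

theorem mem_lineIdeal_of_isHomogeneous [Infinite k] {Y : Fin (n + 1) → k}
    {f : MvPolynomial (Fin (n + 1)) k} {m : ℕ} (hf : f.IsHomogeneous m)
    (h : MvPolynomial.eval Y f = 0) : f ∈ lineIdeal Y := by
  rw [mem_lineIdeal_iff]
  intro c _
  rw [eval_smul_of_isHomogeneous hf, h, mul_zero]

theorem eval_eq_zero_of_mem_lineIdeal [Infinite k] {Y : Fin (n + 1) → k}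
    {f : MvPolynomial (Fin (n + 1)) k} (h : f ∈ lineIdeal Y) : MvPolynomial.eval Y f = 0 := by
  simpa using (mem_lineIdeal_iff Y f).mp h 1 one_ne_zero

theorem isHomogeneous_cross {R : Type*} [CommRing R]
    {F G : Fin (n + 1) → MvPolynomial (Fin (n + 1)) R}
    {m m' : ℕ} (hF : ∀ i, (F i).IsHomogeneous m) (hG : ∀ i, (G i).IsHomogeneous m')
    (i j : Fin (n + 1)) : (F i * G j - F j * G i).IsHomogeneous (m + m') :=
  ((hF i).mul (hG j)).sub ((hF j).mul (hG i))

/-- The ideal contains the linear forms `x_a T_j - x_j T_a`, which cut out the line. -/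
theorem lineIdeal_rep_injective [Infinite k] :
    Function.Injective fun x : ℙ k (Fin (n + 1) → k) => lineIdeal x.rep := by
  intro x y hxy
  simp only at hxy
  obtain ⟨a, ha⟩ := Function.ne_iff.mp x.rep_nonzero
  have hcross : ∀ j, x.rep a * y.rep j = x.rep j * y.rep a := by
    intro j
    have h1 : (MvPolynomial.C (x.rep a) * MvPolynomial.X j -
        MvPolynomial.C (x.rep j) * MvPolynomial.X a : MvPolynomial (Fin (n + 1)) k) ∈
        lineIdeal x.rep := by
      rw [mem_lineIdeal_iff]
      intro c _
      simp only [map_sub, map_mul, MvPolynomial.eval_C, MvPolynomial.eval_X, Pi.smul_apply,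
        smul_eq_mul]
      ring
    rw [hxy] at h1
    have h2 := eval_eq_zero_of_mem_lineIdeal h1
    simpa [sub_eq_zero] using h2
  rw [← x.mk_rep, ← y.mk_rep, eq_comm, Projectivization.mk_eq_mk_iff']
  refine ⟨y.rep a / x.rep a, ?_⟩
  funext j
  have ha' : x.rep a ≠ 0 := ha
  simp only [Pi.smul_apply, smul_eq_mul]
  field_simp
  linear_combination -hcross j

namespace ProjectiveCurve

variable (C : ProjectiveCurve k n)

theorem eval_eq_zero_of_mem_ideal {f : MvPolynomial (Fin (n + 1)) k} (hf : f ∈ C.ideal)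
    {X : Fin (n + 1) → k} (hX : X ≠ 0) (hXC : Projectivization.mk k X hX ∈ C.carrier) :
    MvPolynomial.eval X f = 0 := by
  rw [← MvPolynomial.aeval_eq_eval]
  exact hf X ⟨hX, hXC⟩

theorem eval_rep_eq_zero {f : MvPolynomial (Fin (n + 1)) k} (hf : f ∈ C.ideal) (y : C.carrier) :
    MvPolynomial.eval y.1.rep f = 0 :=
  C.eval_eq_zero_of_mem_ideal hf y.1.rep_nonzero (by rw [Projectivization.mk_rep]; exact y.2)

theorem ideal_le_lineIdeal [Infinite k] (y : C.carrier) : C.ideal ≤ lineIdeal y.1.rep := by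
  intro f hf
  rw [mem_lineIdeal_iff]
  intro c hc
  refine C.eval_eq_zero_of_mem_ideal hf (smul_ne_zero hc y.1.rep_nonzero) ?_
  have : Projectivization.mk k (c • y.1.rep) (smul_ne_zero hc y.1.rep_nonzero) = y.1 := by
    conv_rhs => rw [← y.1.mk_rep]
    rw [Projectivization.mk_eq_mk_iff']
    exact ⟨c, rfl⟩
  rw [this]
  exact y.2

/-- A form outside the ideal of a curve has finitely many zeros on the curve. -/
theorem finite_zeros [Infinite k] {P : MvPolynomial (Fin (n + 1)) k} {m : ℕ}
    (hP : P.IsHomogeneous m) (hPC : P ∉ C.ideal) :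
    {y : C.carrier | MvPolynomial.eval y.1.rep P = 0}.Finite := by
  have hinj : Function.Injective fun y : C.carrier => lineIdeal y.1.rep :=
    lineIdeal_rep_injective.comp Subtype.val_injective
  -- The line over each zero turns out to be a minimal prime over `I(C) + (P)`, and a noetherian
  -- ring has finitely many of these.
  refine Set.Finite.of_injOn (f := fun y : C.carrier => lineIdeal y.1.rep) ?_ hinj.injOn
    ((C.ideal ⊔ Ideal.span {P}).finite_minimalPrimes_of_isNoetherianRing)
  intro y hy
  have hPy : P ∈ lineIdeal y.1.rep := mem_lineIdeal_of_isHomogeneous hP hy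
  have hle : C.ideal ⊔ Ideal.span {P} ≤ lineIdeal y.1.rep :=
    sup_le (C.ideal_le_lineIdeal y) ((Ideal.span_singleton_le_iff_mem _).mpr hPy)
  obtain ⟨q, hq, hqy⟩ := Ideal.exists_minimalPrimes_le hle
  suffices h : q = lineIdeal y.1.rep by
    simp only
    rwa [← h]
  by_contra hne
  have hqp : q.IsPrime := hq.1.1
  have hIq : C.ideal ≤ q := le_sup_left.trans hq.1.2
  let 𝔪 : Ideal (MvPolynomial (Fin (n + 1)) k) := RingHom.ker (MvPolynomial.eval 0)
  have h𝔪 : 𝔪.IsPrime := RingHom.ker_isPrime _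
  have h1 : C.ideal < q := by
    refine lt_of_le_of_ne hIq fun h => hPC ?_
    rw [h]
    exact hq.1.2 (Ideal.mem_sup_right (Ideal.mem_span_singleton_self P))
  have h2 : q < lineIdeal y.1.rep := lt_of_le_of_ne hqy hne
  have h3 : lineIdeal y.1.rep < 𝔪 := by
    refine lt_of_le_of_ne (fun f hf => eval_zero_of_mem_lineIdeal hf) fun h => ?_
    obtain ⟨a, ha⟩ := Function.ne_iff.mp y.1.rep_nonzero
    have hX : (MvPolynomial.X a : MvPolynomial (Fin (n + 1)) k) ∈ lineIdeal y.1.rep := by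
      rw [h]
      simp [𝔪, RingHom.mem_ker]
    exact ha (by simpa using eval_eq_zero_of_mem_lineIdeal hX)
  -- A smaller prime `q` would give the chain `I(C) < q < lineIdeal < 𝔪` of length three, while the
  -- coordinate ring has dimension two.
  let z : Fin 4 → PrimeSpectrum.zeroLocus (C.ideal : Set (MvPolynomial (Fin (n + 1)) k)) :=
    ![⟨⟨C.ideal, C.isPrime⟩, fun _ h => h⟩, ⟨⟨q, hqp⟩, hIq⟩,
      ⟨⟨lineIdeal y.1.rep, inferInstance⟩, hIq.trans hqy⟩, ⟨⟨𝔪, h𝔪⟩, (hIq.trans hqy).trans h3.le⟩]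
  let chain : LTSeries (PrimeSpectrum.zeroLocus (C.ideal : Set (MvPolynomial (Fin (n + 1)) k))) :=
    { length := 3
      toFun := z
      step := by
        intro i
        fin_cases i
        exacts [h1, h2, h3] }
  have h4 := Order.LTSeries.length_le_krullDim chain
  rw [← ringKrullDim_quotient, C.dimension] at h4
  have h5 : ((3 : ℕ) : WithBot ℕ∞) ≤ ((2 : ℕ) : WithBot ℕ∞) := h4
  norm_cast at h5

theorem toCoordField_eq_iff (F G : MvPolynomial (Fin (n + 1)) k) :
    C.toCoordField F = C.toCoordField G ↔ F - G ∈ C.ideal := by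
  rw [toCoordField, toCoordField, (IsFractionRing.injective _ C.CoordField).eq_iff,
    Ideal.Quotient.eq]

theorem toCoordField_mul (F G : MvPolynomial (Fin (n + 1)) k) :
    C.toCoordField (F * G) = C.toCoordField F * C.toCoordField G := by
  simp [toCoordField]

theorem toCoordField_eq_zero_iff (F : MvPolynomial (Fin (n + 1)) k) :
    C.toCoordField F = 0 ↔ F ∈ C.ideal := by
  have := C.toCoordField_eq_iff F 0
  simpa [toCoordField] using this

theorem aeval_toCoordField (P : Fin (n + 1) → MvPolynomial (Fin (n + 1)) k)
    (F : MvPolynomial (Fin (n + 1)) k) :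
    MvPolynomial.aeval (fun i => C.toCoordField (P i)) F =
      C.toCoordField (MvPolynomial.bind₁ P F) := by
  have h : ∀ G, C.toCoordField G = (Algebra.ofId _ C.CoordField).restrictScalars k
      (Ideal.Quotient.mkₐ k C.ideal G) := fun G => rfl
  simp only [h]
  rw [← AlgHom.comp_apply, ← AlgHom.comp_apply]
  refine DFunLike.congr_fun ?_ F
  ext i
  simp

end ProjectiveCurve

/-- Substituting `Ψ` turns forms in `P` into forms in `Q`, and the power of `c` cancels because
numerator and denominator have equal degree. -/
theorem ratioField_le {L : Type*} [Field L] [Algebra k L] {P Q : Fin (n + 1) → L}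
    {Ψ : Fin (n + 1) → MvPolynomial (Fin (n + 1)) k} (hΨ : IsFormTuple Ψ) {c : L} (hc : c ≠ 0)
    (h : ∀ i, P i = c * MvPolynomial.aeval Q (Ψ i)) :
    ratioField (k := k) P ≤ ratioField Q := by
  obtain ⟨d, hd⟩ := hΨ
  have key : ∀ (m : ℕ) (F : MvPolynomial (Fin (n + 1)) k), F.IsHomogeneous m →
      MvPolynomial.aeval P F = c ^ m * MvPolynomial.aeval Q (MvPolynomial.bind₁ Ψ F) := by
    intro m F hF
    have hP : P = c • fun i => MvPolynomial.aeval Q (Ψ i) := funext h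
    rw [MvPolynomial.aeval_bind₁, hP, MvPolynomial.aeval_def, MvPolynomial.aeval_def,
      ← MvPolynomial.eval_map, ← MvPolynomial.eval_map]
    exact eval_smul_of_isHomogeneous (hF.map _) _ _
  rintro a ⟨m, F, G, hF, hG, hG0, rfl⟩
  rw [key m G hG] at hG0
  refine ⟨d * m, MvPolynomial.bind₁ Ψ F, MvPolynomial.bind₁ Ψ G, hF.aeval Ψ hd, hG.aeval Ψ hd,
    right_ne_zero_of_mul hG0, ?_⟩
  rw [key m F hF, key m G hG, mul_div_mul_left _ _ (pow_ne_zero m hc)]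

/-- If `F` is not in the prime ideal `I` and `G`, `H` are proportional to `F` modulo `I`, then `G`
and `H` are proportional modulo `I`. -/
theorem cross_mem_of_cross_mem {R : Type*} [CommRing R] {I : Ideal R} [hI : I.IsPrime]
    {ι : Type*} {F G H : ι → R} {a : ι} (ha : F a ∉ I) (hG : ∀ i j, F i * G j - F j * G i ∈ I)
    (hH : ∀ i j, F i * H j - F j * H i ∈ I) (i j : ι) : G i * H j - G j * H i ∈ I := by
  have h : F a * F a * (G i * H j - G j * H i) ∈ I := by
    have e : F a * F a * (G i * H j - G j * H i) =
        (F a * G i - F i * G a) * (F a * H j) + (F i * G a) * (F a * H j - F j * H a)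
        - ((F a * G j - F j * G a) * (F a * H i) + (F j * G a) * (F a * H i - F i * H a)) := by
      ring
    rw [e]
    exact I.sub_mem (I.add_mem (I.mul_mem_right _ (hG _ _)) (I.mul_mem_left _ (hH _ _)))
      (I.add_mem (I.mul_mem_right _ (hG _ _)) (I.mul_mem_left _ (hH _ _)))
  exact (hI.mem_or_mem h).resolve_left fun h' => (hI.mem_or_mem h').elim ha ha

/-- The forms `Φ` represent the map `ψ` on the curve `C`, and have no common zero at `y₀`. -/
structure Represents {C : ProjectiveCurve k n} (ψ : C.carrier → C.carrier) (y₀ : C.carrier)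
    (Φ : Fin (n + 1) → MvPolynomial (Fin (n + 1)) k) : Prop where
  isFormTuple : IsFormTuple Φ
  exists_ne_zero : ∃ i, MvPolynomial.eval y₀.1.rep (Φ i) ≠ 0
  proportional : ∀ y i j, (ψ y).1.rep i * MvPolynomial.eval y.1.rep (Φ j) =
    (ψ y).1.rep j * MvPolynomial.eval y.1.rep (Φ i)

namespace Represents

variable {C : ProjectiveCurve k n}

theorem exists_eq_smul {ψ : C.carrier → C.carrier} {y₀ : C.carrier}
    {Φ : Fin (n + 1) → MvPolynomial (Fin (n + 1)) k} (h : Represents ψ y₀ Φ) (y : C.carrier) :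
    ∃ c : k, (fun i => MvPolynomial.eval y.1.rep (Φ i)) = c • (ψ y).1.rep := by
  obtain ⟨a, ha⟩ := Function.ne_iff.mp (ψ y).1.rep_nonzero
  have ha' : (ψ y).1.rep a ≠ 0 := ha
  refine ⟨MvPolynomial.eval y.1.rep (Φ a) / (ψ y).1.rep a, funext fun j => ?_⟩
  simp only [Pi.smul_apply, smul_eq_mul]
  field_simp
  linear_combination h.proportional y a j

theorem id (y₀ : C.carrier) : Represents (C := C) id y₀ MvPolynomial.X where
  isFormTuple := ⟨1, fun i => MvPolynomial.isHomogeneous_X _ i⟩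
  exists_ne_zero := by simpa [Function.ne_iff] using y₀.1.rep_nonzero
  proportional y i j := by simp [mul_comm]

/-- Substituted forms change by `c^m`. The factor `c` may vanish at other points, where
proportionality is then trivial, but not at `y₀`. -/
theorem comp {ψ φ : C.carrier → C.carrier} {y₀ : C.carrier}
    {Ψ Φ : Fin (n + 1) → MvPolynomial (Fin (n + 1)) k} (hψ : Represents ψ (φ y₀) Ψ)
    (hφ : Represents φ y₀ Φ) :
    Represents (ψ ∘ φ) y₀ fun i => MvPolynomial.bind₁ Φ (Ψ i) := by
  obtain ⟨d, hd⟩ := hφ.isFormTuple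
  obtain ⟨m, hm⟩ := hψ.isFormTuple
  have key : ∀ y : C.carrier, ∃ c : k,
      (fun i => MvPolynomial.eval y.1.rep (Φ i)) = c • (φ y).1.rep ∧
      ∀ i, MvPolynomial.eval y.1.rep (MvPolynomial.bind₁ Φ (Ψ i)) =
        c ^ m * MvPolynomial.eval (φ y).1.rep (Ψ i) := by
    intro y
    obtain ⟨c, hc⟩ := hφ.exists_eq_smul y
    refine ⟨c, hc, fun i => ?_⟩
    rw [← eval_smul_of_isHomogeneous (hm i), ← hc, ← MvPolynomial.aeval_eq_eval,
      MvPolynomial.aeval_eq_eval]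
    rw [← MvPolynomial.aeval_eq_eval, ← MvPolynomial.aeval_eq_eval]
    exact MvPolynomial.aeval_bind₁ _ _ _
  refine ⟨⟨d * m, fun i => (hm i).aeval Φ hd⟩, ?_, fun y i j => ?_⟩
  · obtain ⟨c, hc, hc'⟩ := key y₀
    obtain ⟨i, hi⟩ := hψ.exists_ne_zero
    refine ⟨i, ?_⟩
    rw [hc']
    refine mul_ne_zero (pow_ne_zero _ ?_) hi
    rintro rfl
    obtain ⟨j, hj⟩ := hφ.exists_ne_zero
    exact hj (by simpa using congrFun hc j)
  · obtain ⟨c, -, hc'⟩ := key y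
    rw [hc', hc']
    have := hψ.proportional (φ y) i j
    simp only [Function.comp_apply]
    linear_combination c ^ m * this

end Represents

namespace SelfMorphism

variable {C : ProjectiveCurve k n} (φ : SelfMorphism C)

theorem represents {G : Fin (n + 1) → MvPolynomial (Fin (n + 1)) k} (hG : IsFormTuple G)
    (hcross : ∀ i j, φ.form i * G j - φ.form j * G i ∈ C.ideal) {y₀ : C.carrier}
    (h0 : ∃ i, MvPolynomial.eval y₀.1.rep (G i) ≠ 0) : Represents φ.toFun y₀ G := by
  refine ⟨hG, h0, fun y i j => ?_⟩
  obtain ⟨H, -, hH, hH0, hy⟩ := φ.exists_representation y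
  obtain ⟨a, ha⟩ := φ.exists_notMem
  have hGH := C.eval_rep_eq_zero (cross_mem_of_cross_mem ha hcross hH i j) y
  obtain ⟨c, hc⟩ := Projectivization.exists_smul_eq_mk_rep k _ hH0
  rw [← hy] at hc
  simp only [map_sub, map_mul] at hGH
  rw [← hc]
  simp only [Pi.smul_apply, Units.smul_def, smul_eq_mul]
  linear_combination (-(c : k)) * hGH

theorem exists_represents (y₀ : C.carrier) :
    ∃ G : Fin (n + 1) → MvPolynomial (Fin (n + 1)) k,
      (∀ i j, φ.form i * G j - φ.form j * G i ∈ C.ideal) ∧ Represents φ.toFun y₀ G := by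
  obtain ⟨G, hG, hcross, h0, -⟩ := φ.exists_representation y₀
  exact ⟨G, hcross, φ.represents hG hcross (by simpa [Function.ne_iff] using h0)⟩

theorem exists_represents_iterate (N : ℕ) (y₀ : C.carrier) :
    ∃ Φ : Fin (n + 1) → MvPolynomial (Fin (n + 1)) k, Represents φ.toFun^[N] y₀ Φ := by
  induction N generalizing y₀ with
  | zero => exact ⟨_, Represents.id y₀⟩
  | succ N ih =>
    obtain ⟨G, -, hG⟩ := φ.exists_represents y₀
    obtain ⟨Ψ, hΨ⟩ := ih (φ.toFun y₀)
    exact ⟨_, hΨ.comp hG⟩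

/-- No iterate of a morphism of degree greater than one has infinitely many fixed points. -/
theorem finite_fixedPoints_iterate [Infinite k] (hdeg : 1 < φ.degree) {N : ℕ} (hN : N ≠ 0) :
    {y : C.carrier | φ.toFun^[N] y = y}.Finite := by
  obtain ⟨N, rfl⟩ := Nat.exists_eq_succ_of_ne_zero hN
  by_contra hinf
  have hinf : {y : C.carrier | φ.toFun^[N + 1] y = y}.Infinite := hinf
  obtain ⟨y₀, -⟩ := hinf.nonempty
  obtain ⟨G, hFG, hG⟩ := φ.exists_represents y₀
  obtain ⟨Ψ, hΨ⟩ := φ.exists_represents_iterate N (φ.toFun y₀)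
  have hΦ := hΨ.comp hG
  obtain ⟨a, ha⟩ := hΦ.exists_ne_zero
  obtain ⟨m, hm⟩ := hΦ.isFormTuple
  set Φ := fun i => MvPolynomial.bind₁ G (Ψ i) with hΦdef
  -- These minors vanish at the infinitely many fixed points, so the iterate is the identity as a
  -- rational map.
  have hXΦ : ∀ i j, MvPolynomial.X i * Φ j - MvPolynomial.X j * Φ i ∈ C.ideal := by
    intro i j
    by_contra hnot
    refine hinf ((C.finite_zeros (isHomogeneous_cross
      (fun i => MvPolynomial.isHomogeneous_X k i) hm i j) hnot).subset fun y hy => ?_)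
    have hy' : (φ.toFun^[N] ∘ φ.toFun) y = y := hy
    have h := hΦ.proportional y i j
    rw [hy'] at h
    simp only [Set.mem_ofPred_eq, map_sub, map_mul, MvPolynomial.eval_X]
    exact sub_eq_zero.mpr h
  have hne : ∀ {F : MvPolynomial (Fin (n + 1)) k}, MvPolynomial.eval y₀.1.rep F ≠ 0 →
      C.toCoordField F ≠ 0 := by
    intro F hF h
    exact hF (C.eval_rep_eq_zero ((C.toCoordField_eq_zero_iff F).mp h) y₀)
  have hΦa := hne ha
  have hXeq : ∀ i, C.toCoordField (MvPolynomial.X i) * C.toCoordField (Φ a) =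
      C.toCoordField (MvPolynomial.X a) * C.toCoordField (Φ i) := by
    intro i
    rw [← C.toCoordField_mul, ← C.toCoordField_mul, C.toCoordField_eq_iff]
    exact hXΦ i a
  have hXa : C.toCoordField (MvPolynomial.X a) ≠ 0 := by
    intro h
    obtain ⟨b, hb⟩ := Function.ne_iff.mp y₀.1.rep_nonzero
    have hXb : C.toCoordField (MvPolynomial.X b) ≠ 0 := hne (by simpa using hb)
    have := hXeq b
    rw [h, zero_mul] at this
    exact mul_ne_zero hXb hΦa this
  -- Since `Φ = Ψ(G)`, the coordinates are `X_i = (X_a / Φ_a) Ψ_i(G)`: `K` is generated by pullbacks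
  -- along `φ`.
  have h1 : C.functionField ≤ ratioField fun i => C.toCoordField (G i) := by
    refine ratioField_le hΨ.isFormTuple (div_ne_zero hXa hΦa) fun i => ?_
    rw [C.aeval_toCoordField, div_mul_eq_mul_div, eq_div_iff hΦa]
    exact hXeq i
  obtain ⟨b, hb⟩ := φ.exists_notMem
  have hFb : C.toCoordField (φ.form b) ≠ 0 := fun h => hb ((C.toCoordField_eq_zero_iff _).mp h)
  have hFG' : ∀ i, C.toCoordField (φ.form b) * C.toCoordField (G i) =
      C.toCoordField (φ.form i) * C.toCoordField (G b) := by
    intro i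
    rw [← C.toCoordField_mul, ← C.toCoordField_mul, C.toCoordField_eq_iff]
    exact hFG b i
  have hGb : C.toCoordField (G b) ≠ 0 := by
    intro h
    obtain ⟨c, hc⟩ := hG.exists_ne_zero
    have := hFG' c
    rw [h, mul_zero] at this
    exact mul_ne_zero hFb (hne hc) this
  have h2 : (ratioField fun i => C.toCoordField (G i)) ≤ φ.pullbackField := by
    refine ratioField_le (Ψ := MvPolynomial.X) ⟨1, fun i => MvPolynomial.isHomogeneous_X k i⟩
      (div_ne_zero hGb hFb) fun i => ?_
    rw [MvPolynomial.aeval_X, div_mul_eq_mul_div, eq_div_iff hFb]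
    linear_combination hFG' i
  have h3 : φ.degree = 1 := IntermediateField.relfinrank_eq_one_iff.mpr (h1.trans h2)
  omega

end SelfMorphism

end Finiteness

/-! ### Taylor expansion of polynomials modulo powers of an ideal. -/

section Taylor

variable {A R σ : Type*} [CommRing A] [CommRing R] (κ : A →+* R) (X u : σ → R) {M : Ideal R}

theorem eval₂_add_sub_mem (hu : ∀ a, u a ∈ M) (f : MvPolynomial σ A) :
    f.eval₂ κ (X + u) - f.eval₂ κ X ∈ M := by
  induction f using MvPolynomial.induction_on with
  | C a => simp
  | add f g hf hg =>
    rw [MvPolynomial.eval₂_add, MvPolynomial.eval₂_add, add_sub_add_comm]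
    exact M.add_mem hf hg
  | mul_X f i hf =>
    rw [MvPolynomial.eval₂_mul, MvPolynomial.eval₂_mul, MvPolynomial.eval₂_X,
      MvPolynomial.eval₂_X, Pi.add_apply]
    have e : f.eval₂ κ (X + u) * (X i + u i) - f.eval₂ κ X * X i =
        X i * (f.eval₂ κ (X + u) - f.eval₂ κ X) + f.eval₂ κ (X + u) * u i := by ring
    rw [e]
    exact M.add_mem (M.mul_mem_left _ hf) (M.mul_mem_left _ (hu i))

theorem eval₂_add_sub_sub_mem [Fintype σ] (hu : ∀ a, u a ∈ M) (f : MvPolynomial σ A) :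
    f.eval₂ κ (X + u) - f.eval₂ κ X - ∑ a, (MvPolynomial.pderiv a f).eval₂ κ X * u a ∈ M ^ 2 := by
  classical
  induction f using MvPolynomial.induction_on with
  | C a => simp
  | add f g hf hg =>
    have e : (f + g).eval₂ κ (X + u) - (f + g).eval₂ κ X -
        ∑ a, (MvPolynomial.pderiv a (f + g)).eval₂ κ X * u a =
        (f.eval₂ κ (X + u) - f.eval₂ κ X - ∑ a, (MvPolynomial.pderiv a f).eval₂ κ X * u a) +
        (g.eval₂ κ (X + u) - g.eval₂ κ X - ∑ a, (MvPolynomial.pderiv a g).eval₂ κ X * u a) := by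
      simp only [MvPolynomial.eval₂_add, map_add, add_mul, Finset.sum_add_distrib]
      ring
    rw [e]
    exact (M ^ 2).add_mem hf hg
  | mul_X f i hf =>
    have e : (f * MvPolynomial.X i).eval₂ κ (X + u) - (f * MvPolynomial.X i).eval₂ κ X -
        ∑ a, (MvPolynomial.pderiv a (f * MvPolynomial.X i)).eval₂ κ X * u a =
        X i * (f.eval₂ κ (X + u) - f.eval₂ κ X - ∑ a, (MvPolynomial.pderiv a f).eval₂ κ X * u a) +
        (f.eval₂ κ (X + u) - f.eval₂ κ X) * u i := by
      have h : ∀ a, (MvPolynomial.pderiv a (f * MvPolynomial.X i)).eval₂ κ X * u a =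
          X i * ((MvPolynomial.pderiv a f).eval₂ κ X * u a) +
            if i = a then f.eval₂ κ X * u a else 0 := by
        intro a
        rw [Derivation.leibniz, MvPolynomial.pderiv_X, smul_eq_mul, smul_eq_mul,
          MvPolynomial.eval₂_add, MvPolynomial.eval₂_mul, MvPolynomial.eval₂_mul,
          MvPolynomial.eval₂_X]
        by_cases hia : i = a
        · subst hia
          simp only [Pi.single_eq_same, MvPolynomial.eval₂_one, if_true]
          ring
        · rw [Pi.single_eq_of_ne hia, if_neg hia, MvPolynomial.eval₂_zero]
          ring
      simp only [h, Finset.sum_add_distrib, ← Finset.mul_sum, Finset.sum_ite_eq,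
        Finset.mem_univ, if_true, MvPolynomial.eval₂_mul, MvPolynomial.eval₂_X, Pi.add_apply]
      ring
    rw [e]
    refine (M ^ 2).add_mem ((M ^ 2).mul_mem_left _ hf) ?_
    rw [pow_two]
    exact Ideal.mul_mem_mul (eval₂_add_sub_mem κ X u hu f) (hu i)

end Taylor

/-! ### Reduction and integral polynomials on the unit polydisc. -/

section Integers

variable (p : ℕ) [Fact p.Prime]

theorem norm_coe_le_one (z : 𝓞_ℂ_[p]) : ‖(z : ℂ_[p])‖ ≤ 1 := (mem_integers_iff p z).mp z.2

theorem norm_eq_one_of_residue_ne_zero {z : 𝓞_ℂ_[p]} (hz : IsLocalRing.residue 𝓞_ℂ_[p] z ≠ 0) :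
    ‖(z : ℂ_[p])‖ = 1 := by
  rw [IsLocalRing.residue_ne_zero_iff_isUnit] at hz
  obtain ⟨w, hw⟩ := hz.exists_right_inv
  have h : ‖(z : ℂ_[p])‖ * ‖(w : ℂ_[p])‖ = 1 := by
    rw [← norm_mul]
    have : (z : ℂ_[p]) * (w : ℂ_[p]) = 1 := by exact_mod_cast congrArg Subtype.val hw
    rw [this, norm_one]
  have h1 := norm_coe_le_one p z
  have h2 := norm_coe_le_one p w
  nlinarith [norm_nonneg (z : ℂ_[p])]

theorem norm_lt_one_of_residue_eq_zero {z : 𝓞_ℂ_[p]} (hz : IsLocalRing.residue 𝓞_ℂ_[p] z = 0) :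
    ‖(z : ℂ_[p])‖ < 1 := by
  refine lt_of_le_of_ne (norm_coe_le_one p z) fun h => ?_
  have hz0 : (z : ℂ_[p]) ≠ 0 := by
    intro h0
    rw [h0, norm_zero] at h
    exact zero_ne_one h
  have hinv : (z : ℂ_[p])⁻¹ ∈ 𝓞_ℂ_[p] := by
    rw [mem_integers_iff, norm_inv, h, inv_one]
  have hu : IsUnit z := IsUnit.of_mul_eq_one ⟨_, hinv⟩ (Subtype.ext (mul_inv_cancel₀ hz0))
  exact (IsLocalRing.residue_ne_zero_iff_isUnit z).mpr hu hz

variable {p} {n : ℕ}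

theorem norm_aeval_le_one {Y : Fin (n + 1) → ℂ_[p]} (hY : ∀ j, ‖Y j‖ ≤ 1)
    (f : MvPolynomial (Fin (n + 1)) 𝓞_ℂ_[p]) : ‖MvPolynomial.aeval Y f‖ ≤ 1 := by
  induction f using MvPolynomial.induction_on with
  | C a =>
    rw [MvPolynomial.aeval_C]
    exact norm_coe_le_one p a
  | add f g hf hg =>
    rw [map_add]
    exact (IsUltrametricDist.norm_add_le_max _ _).trans (max_le hf hg)
  | mul_X f i hf =>
    rw [map_mul, norm_mul, MvPolynomial.aeval_X]
    exact mul_le_one₀ hf (norm_nonneg _) (hY i)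

theorem norm_aeval_sub_lt {X Y : Fin (n + 1) → ℂ_[p]} {r : ℝ} (hr : 0 < r)
    (hX : ∀ j, ‖X j‖ ≤ 1) (hY : ∀ j, ‖Y j‖ ≤ 1) (hXY : ∀ j, ‖Y j - X j‖ < r)
    (f : MvPolynomial (Fin (n + 1)) 𝓞_ℂ_[p]) :
    ‖MvPolynomial.aeval Y f - MvPolynomial.aeval X f‖ < r := by
  induction f using MvPolynomial.induction_on with
  | C a => simpa using hr
  | add f g hf hg =>
    rw [map_add, map_add, add_sub_add_comm]
    exact (IsUltrametricDist.norm_add_le_max _ _).trans_lt (max_lt hf hg)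
  | mul_X f i hf =>
    rw [map_mul, map_mul, MvPolynomial.aeval_X, MvPolynomial.aeval_X]
    have e : MvPolynomial.aeval Y f * Y i - MvPolynomial.aeval X f * X i =
        (MvPolynomial.aeval Y f - MvPolynomial.aeval X f) * Y i +
          MvPolynomial.aeval X f * (Y i - X i) := by ring
    rw [e]
    refine (IsUltrametricDist.norm_add_le_max _ _).trans_lt (max_lt ?_ ?_) <;> rw [norm_mul]
    · exact (mul_le_of_le_one_right (norm_nonneg _) (hY i)).trans_lt hf
    · exact (mul_le_of_le_one_left (norm_nonneg _) (norm_aeval_le_one hX f)).trans_lt (hXY i)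

end Integers

/-! ### The metric `Δ` in affine charts. -/

section Charts

variable {p : ℕ} [Fact p.Prime] {n : ℕ}

theorem exists_norm_apply_eq (Y : Fin (n + 1) → ℂ_[p]) : ∃ i, ‖Y i‖ = ‖Y‖ := by
  obtain ⟨i, hi⟩ := Finite.exists_max fun i => ‖Y i‖
  exact ⟨i, le_antisymm (norm_le_pi_norm Y i)
    ((pi_norm_le_iff_of_nonneg (norm_nonneg _)).mpr hi)⟩

/-- The index of a homogeneous coordinate of maximal absolute value. -/
def pivot (x : ℙ ℂ_[p] (Fin (n + 1) → ℂ_[p])) : Fin (n + 1) :=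
  (exists_norm_apply_eq x.rep).choose

theorem norm_rep_pivot (x : ℙ ℂ_[p] (Fin (n + 1) → ℂ_[p])) : ‖x.rep (pivot x)‖ = ‖x.rep‖ :=
  (exists_norm_apply_eq x.rep).choose_spec

theorem rep_pivot_ne_zero (x : ℙ ℂ_[p] (Fin (n + 1) → ℂ_[p])) : x.rep (pivot x) ≠ 0 := by
  rw [← norm_ne_zero_iff, norm_rep_pivot, norm_ne_zero_iff]
  exact x.rep_nonzero

/-- Homogeneous coordinates, normalized by setting the coordinate with index `i` equal to one. -/
def affine (i : Fin (n + 1)) (x : ℙ ℂ_[p] (Fin (n + 1) → ℂ_[p])) : Fin (n + 1) → ℂ_[p] :=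
  (x.rep i)⁻¹ • x.rep

theorem affine_apply (i j : Fin (n + 1)) (x : ℙ ℂ_[p] (Fin (n + 1) → ℂ_[p])) :
    affine i x j = x.rep j / x.rep i := by
  rw [affine, Pi.smul_apply, smul_eq_mul, div_eq_inv_mul]

theorem affine_self {i : Fin (n + 1)} {x : ℙ ℂ_[p] (Fin (n + 1) → ℂ_[p])} (h : x.rep i ≠ 0) :
    affine i x i = 1 := by
  rw [affine_apply, div_self h]

theorem affine_ne_zero {i : Fin (n + 1)} {x : ℙ ℂ_[p] (Fin (n + 1) → ℂ_[p])} (h : x.rep i ≠ 0) :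
    affine i x ≠ 0 := fun h0 => by
  have := affine_self h
  rw [h0] at this
  exact zero_ne_one this

theorem mk_affine {i : Fin (n + 1)} {x : ℙ ℂ_[p] (Fin (n + 1) → ℂ_[p])} (h : x.rep i ≠ 0) :
    Projectivization.mk ℂ_[p] (affine i x) (affine_ne_zero h) = x := by
  conv_rhs => rw [← x.mk_rep]
  rw [Projectivization.mk_eq_mk_iff']
  exact ⟨_, rfl⟩

theorem norm_affine_pivot_le (x : ℙ ℂ_[p] (Fin (n + 1) → ℂ_[p])) (j : Fin (n + 1)) :
    ‖affine (pivot x) x j‖ ≤ 1 := by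
  rw [affine_apply, norm_div, norm_rep_pivot]
  exact div_le_one_of_le₀ (norm_le_pi_norm _ _) (norm_nonneg _)

/-- A pivot `i` of `x` is also one of `y`: if `y_b` is maximal, then `x_i y_b` strictly dominates
the minor, so `|x_b y_i| = |x| |y|`. Dividing minors by `x_i y_i` gives the coordinate differences,
so one chart serves the whole disc. -/
theorem affine_sub_of_Delta_lt {x y : ℙ ℂ_[p] (Fin (n + 1) → ℂ_[p])} {r : ℝ} (hr : r ≤ 1)
    (h : Delta p x y < r) :
    y.rep (pivot x) ≠ 0 ∧ ∀ j, ‖affine (pivot x) y j - affine (pivot x) x j‖ < r := by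
  have hX := rep_pivot_ne_zero x
  have hX' := norm_rep_pivot x
  set i := pivot x
  have hx0 : 0 < ‖x.rep‖ := norm_pos_iff.mpr x.rep_nonzero
  have hy0 : 0 < ‖y.rep‖ := norm_pos_iff.mpr y.rep_nonzero
  rw [Delta, div_lt_iff₀ (by positivity)] at h
  have h1 : ∀ b, ‖x.rep i * y.rep b - x.rep b * y.rep i‖ < r * (‖x.rep‖ * ‖y.rep‖) := fun b =>
    (norm_le_pi_norm (fun ij : Fin (n + 1) × Fin (n + 1) =>
      x.rep ij.1 * y.rep ij.2 - x.rep ij.2 * y.rep ij.1) (i, b)).trans_lt h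
  have h2 : ‖y.rep i‖ = ‖y.rep‖ := by
    obtain ⟨b, hb⟩ := exists_norm_apply_eq y.rep
    have h3 : ‖x.rep b * y.rep i‖ = ‖x.rep i * y.rep b‖ := by
      refine norm_eq_of_norm_sub_lt ((h1 b).trans_le ?_)
      rw [norm_mul, hX', hb]
      exact mul_le_of_le_one_left (by positivity) hr
    rw [norm_mul, norm_mul, hX', hb] at h3
    refine le_antisymm (norm_le_pi_norm _ _) (le_of_mul_le_mul_left ?_ hx0)
    rw [← h3]
    exact mul_le_mul_of_nonneg_right (norm_le_pi_norm _ _) (norm_nonneg _)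
  have hY : y.rep i ≠ 0 := by
    rw [← norm_ne_zero_iff, h2]
    exact hy0.ne'
  refine ⟨hY, fun b => ?_⟩
  have e : affine i y b - affine i x b =
      (x.rep i * y.rep b - x.rep b * y.rep i) / (x.rep i * y.rep i) := by
    rw [affine_apply, affine_apply]
    field_simp
  rw [e, norm_div, norm_mul (x.rep i), hX', h2, div_lt_iff₀ (by positivity)]
  exact h1 b

theorem Delta_lt_of_norm_sub_lt {x y : ℙ ℂ_[p] (Fin (n + 1) → ℂ_[p])} {r : ℝ} (hr : 0 < r)
    {X Y : Fin (n + 1) → ℂ_[p]} (hX0 : X ≠ 0) (hY0 : Y ≠ 0)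
    (hx : Projectivization.mk ℂ_[p] X hX0 = x) (hy : Projectivization.mk ℂ_[p] Y hY0 = y)
    {i : Fin (n + 1)} (hX : ∀ j, ‖X j‖ ≤ 1) (hY : ∀ j, ‖Y j‖ ≤ 1) (hXi : ‖X i‖ = 1)
    (hYi : ‖Y i‖ = 1) (h : ∀ j, ‖Y j - X j‖ < r) : Delta p x y < r := by
  have key : ∀ {Z : Fin (n + 1) → ℂ_[p]}, (∀ j, ‖Z j‖ ≤ 1) → ‖Z i‖ = 1 → ‖Z‖ = 1 :=
    fun {Z} h1 h2 => le_antisymm ((pi_norm_le_iff_of_nonneg zero_le_one).mpr h1)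
      (h2 ▸ norm_le_pi_norm Z i)
  rw [← hx, ← hy, Delta_mk_of_norm_eq_one p X Y hX0 hY0 (key hX hXi) (key hY hYi),
    pi_norm_lt_iff hr]
  rintro ⟨a, b⟩
  have e : X a * Y b - X b * Y a = X a * (Y b - X b) - X b * (Y a - X a) := by ring
  simp only
  rw [e]
  refine (norm_sub_le_max _ _).trans_lt (max_lt ?_ ?_) <;> rw [norm_mul]
  · exact (mul_le_of_le_one_left (norm_nonneg _) (hX a)).trans_lt (h b)
  · exact (mul_le_of_le_one_left (norm_nonneg _) (hX b)).trans_lt (h a)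

theorem Delta_self (x : ℙ ℂ_[p] (Fin (n + 1) → ℂ_[p])) : Delta p x x = 0 := by
  have : (fun ij : Fin (n + 1) × Fin (n + 1) =>
      x.rep ij.1 * x.rep ij.2 - x.rep ij.2 * x.rep ij.1) = 0 := by
    funext ij
    simp [mul_comm]
  rw [Delta, this, norm_zero, zero_div]

theorem norm_affine_le_one {x y : ℙ ℂ_[p] (Fin (n + 1) → ℂ_[p])} {r : ℝ} (hr : r ≤ 1)
    (h : Delta p x y < r) (j : Fin (n + 1)) : ‖affine (pivot x) y j‖ ≤ 1 := by
  have h1 := ((affine_sub_of_Delta_lt hr h).2 j).le.trans hr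
  have e : affine (pivot x) y j =
      (affine (pivot x) y j - affine (pivot x) x j) + affine (pivot x) x j := by ring
  rw [e]
  exact (IsUltrametricDist.norm_add_le_max _ _).trans (max_le h1 (norm_affine_pivot_le x j))

theorem Delta_lt_of_Delta_lt {x y z : ℙ ℂ_[p] (Fin (n + 1) → ℂ_[p])} {r : ℝ} (hr0 : 0 < r)
    (hr : r ≤ 1) (hy : Delta p x y < r) (hz : Delta p x z < r) : Delta p y z < r := by
  obtain ⟨hy0, hy1⟩ := affine_sub_of_Delta_lt hr hy
  obtain ⟨hz0, hz1⟩ := affine_sub_of_Delta_lt hr hz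
  refine Delta_lt_of_norm_sub_lt hr0 (affine_ne_zero hy0) (affine_ne_zero hz0) (mk_affine hy0)
    (mk_affine hz0) (i := pivot x) (norm_affine_le_one hr hy) (norm_affine_le_one hr hz)
    (by rw [affine_self hy0, norm_one]) (by rw [affine_self hz0, norm_one]) fun j => ?_
  have e : affine (pivot x) z j - affine (pivot x) y j =
      (affine (pivot x) z j - affine (pivot x) x j) -
        (affine (pivot x) y j - affine (pivot x) x j) := by ring
  rw [e]
  exact (norm_sub_le_max _ _).trans_lt (max_lt (hz1 j) (hy1 j))

theorem Delta_pos {x y : ℙ ℂ_[p] (Fin (n + 1) → ℂ_[p])} (hxy : x ≠ y) : 0 < Delta p x y := by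
  have h0 : 0 ≤ Delta p x y := by
    rw [Delta]
    positivity
  refine lt_of_le_of_ne h0 fun h => hxy ?_
  have hlt : ∀ r : ℝ, 0 < r → Delta p x y < r := fun r hr => h ▸ hr
  obtain ⟨hy, -⟩ := affine_sub_of_Delta_lt le_rfl (hlt 1 one_pos)
  have he : affine (pivot x) x = affine (pivot x) y := by
    funext j
    refine (sub_eq_zero.mp (norm_le_zero_iff.mp (le_of_forall_pos_le_add fun ε hε => ?_))).symm
    rw [zero_add]
    have h1 := (affine_sub_of_Delta_lt (min_le_left 1 ε)
      (hlt (min 1 ε) (lt_min one_pos hε))).2 j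
    exact h1.le.trans (min_le_right _ _)
  rw [← mk_affine (rep_pivot_ne_zero x), ← mk_affine hy]
  congr 1

end Charts

/-! ### The Jacobian criterion and the choice of a coordinate. -/

section Jacobian

/-- If the gradients of the elements of `I` at a non-singular point span a space of codimension one,
then the coordinate gradients are gradients of elements of `I` up to multiples of one of them. -/
theorem IsNonsingular.exists_index {k : Type*} [Field k] {n : ℕ}
    {I : Ideal (MvPolynomial (Fin (n + 1)) k)} (hI : IsNonsingular I) {X : Fin (n + 1) → k}
    {i : Fin (n + 1)} (hX : X i = 1) (hX' : ∀ f ∈ I, MvPolynomial.eval X f = 0) :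
    ∃ l, l ≠ i ∧ ∀ j, j ≠ i → ∃ f ∈ I, ∃ c : k, ∀ a, a ≠ i →
      MvPolynomial.eval X (MvPolynomial.pderiv a f) =
        (if a = j then 1 else 0) - if a = l then c else 0 := by
  have hrank := hI X i hX hX'
  set T : Set ({j : Fin (n + 1) // j ≠ i} → k) :=
    {v | ∃ f ∈ I, v = fun j => MvPolynomial.eval X (MvPolynomial.pderiv j.1 f)} with hT
  -- The gradients already form a subspace, as `I` is closed under addition and scalars; thus each
  -- vector of the span is the gradient of a single `f ∈ I`.
  have hspan : ∀ v ∈ Submodule.span k T, v ∈ T := by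
    intro v hv
    induction hv using Submodule.span_induction with
    | mem v hv => exact hv
    | zero => exact ⟨0, I.zero_mem, by funext j; simp⟩
    | add v w _ _ hv hw =>
      obtain ⟨f, hf, rfl⟩ := hv
      obtain ⟨g, hg, rfl⟩ := hw
      exact ⟨f + g, I.add_mem hf hg, by funext j; simp⟩
    | smul c v _ hv =>
      obtain ⟨f, hf, rfl⟩ := hv
      exact ⟨MvPolynomial.C c * f, I.mul_mem_left _ hf, by funext j; simp⟩
  have hcard : Module.finrank k ({j : Fin (n + 1) // j ≠ i} → k) = n := by simp
  -- The span has codimension one, so any coordinate vector outside it spans a complement; its index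
  -- `l` will give the local parameter.
  have hne : ∃ l : {j : Fin (n + 1) // j ≠ i}, Pi.single l (1 : k) ∉ Submodule.span k T := by
    by_contra! hall
    have htop : Submodule.span k T = ⊤ := by
      rw [eq_top_iff, ← (Pi.basisFun k {j : Fin (n + 1) // j ≠ i}).span_eq, Submodule.span_le]
      rintro _ ⟨l, rfl⟩
      rw [Pi.basisFun_apply]
      exact hall l
    rw [htop, finrank_top, hcard] at hrank
    omega
  obtain ⟨l, hl⟩ := hne
  have hsup : Submodule.span k T ⊔ Submodule.span k {Pi.single l (1 : k)} = ⊤ := by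
    have hlt : Submodule.span k T <
        Submodule.span k T ⊔ Submodule.span k {Pi.single l (1 : k)} := by
      refine lt_of_le_of_ne le_sup_left fun h => hl ?_
      rw [h]
      exact Submodule.mem_sup_right (Submodule.mem_span_singleton_self _)
    have h1 := Submodule.finrank_lt_finrank_of_lt hlt
    refine Submodule.eq_top_of_finrank_eq (le_antisymm (Submodule.finrank_le _) ?_)
    rw [hcard]
    omega
  refine ⟨l.1, l.2, fun j hj => ?_⟩
  have hmem : Pi.single (⟨j, hj⟩ : {j : Fin (n + 1) // j ≠ i}) (1 : k) ∈
      Submodule.span k T ⊔ Submodule.span k {Pi.single l (1 : k)} := by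
    rw [hsup]
    trivial
  obtain ⟨v, hv, w, hw, hvw⟩ := Submodule.mem_sup.mp hmem
  obtain ⟨c, rfl⟩ := Submodule.mem_span_singleton.mp hw
  obtain ⟨f, hf, rfl⟩ := hspan v hv
  refine ⟨f, hf, c, fun a ha => ?_⟩
  have h := congrFun hvw ⟨a, ha⟩
  simp only [Pi.add_apply, Pi.smul_apply, Pi.single_apply, Subtype.mk.injEq, smul_eq_mul,
    mul_ite, mul_one, mul_zero] at h
  rw [← h]
  have e : ((⟨a, ha⟩ : {j : Fin (n + 1) // j ≠ i}) = l) ↔ a = l.1 := by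
    rw [Subtype.ext_iff]
  simp only [e, add_sub_cancel_right]

end Jacobian

/-! ### Regular functions on a disc and the local parameter. -/

section Disc

variable {p : ℕ} [Fact p.Prime] {n : ℕ} {C : ProjectiveCurve ℂ_[p] n} {r : ℝ}

/-- The points of the curve `C` at distance less than `r` from `x`. -/
abbrev Disc (r : ℝ) (x : C.carrier) : Type := {y : C.carrier // Delta p x.1 y.1 < r}

/-- The affine coordinates on a disc, in a chart determined by its centre. -/
abbrev coord {x : C.carrier} (y : Disc r x) : Fin (n + 1) → ℂ_[p] := affine (pivot x.1) y.1.1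

/-- The centre of a disc. -/
def Disc.center (hr0 : 0 < r) (x : C.carrier) : Disc r x := ⟨x, by rwa [Delta_self]⟩

theorem norm_coord_le_one (hr : r ≤ 1) {x : C.carrier} (y : Disc r x) (j : Fin (n + 1)) :
    ‖coord y j‖ ≤ 1 := norm_affine_le_one hr y.2 j

theorem norm_coord_sub_lt (hr : r ≤ 1) {x : C.carrier} (y : Disc r x) (j : Fin (n + 1)) :
    ‖coord y j - affine (pivot x.1) x.1 j‖ < r := (affine_sub_of_Delta_lt hr y.2).2 j

theorem norm_aeval_coord_eq_one (hr0 : 0 < r) (hr : r ≤ 1) {x : C.carrier}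
    {b : MvPolynomial (Fin (n + 1)) 𝓞_ℂ_[p]}
    (hb : ‖MvPolynomial.aeval (affine (pivot x.1) x.1) b‖ = 1) (y : Disc r x) :
    ‖MvPolynomial.aeval (coord y) b‖ = 1 := by
  rw [← hb]
  refine norm_eq_of_norm_sub_lt ?_
  rw [norm_sub_rev, hb]
  exact (norm_aeval_sub_lt hr0 (norm_affine_pivot_le x.1) (norm_coord_le_one hr y)
    (norm_coord_sub_lt hr y) b).trans_le hr

/-- The ring of the functions `a / b` on a disc, where `a` and `b` are polynomials with integral
coefficients in the affine coordinates, such that `b` is a unit at the centre of the disc. -/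
def regularRing (hr0 : 0 < r) (hr : r ≤ 1) (x : C.carrier) : Subring (Disc r x → ℂ_[p]) where
  carrier := {h | ∃ a b : MvPolynomial (Fin (n + 1)) 𝓞_ℂ_[p],
    ‖MvPolynomial.aeval (affine (pivot x.1) x.1) b‖ = 1 ∧
    ∀ y, h y = MvPolynomial.aeval (coord y) a / MvPolynomial.aeval (coord y) b}
  zero_mem' := ⟨0, 1, by simp, by simp⟩
  one_mem' := ⟨1, 1, by simp, by simp⟩
  add_mem' := by
    rintro h h' ⟨a, b, hb, H⟩ ⟨a', b', hb', H'⟩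
    refine ⟨a * b' + b * a', b * b', by simp [hb, hb'], fun y => ?_⟩
    have h1 : MvPolynomial.aeval (coord y) b ≠ 0 := norm_ne_zero_iff.mp
      (by rw [norm_aeval_coord_eq_one hr0 hr hb y]; exact one_ne_zero)
    have h2 : MvPolynomial.aeval (coord y) b' ≠ 0 := norm_ne_zero_iff.mp
      (by rw [norm_aeval_coord_eq_one hr0 hr hb' y]; exact one_ne_zero)
    rw [Pi.add_apply, H, H', div_add_div _ _ h1 h2]
    simp only [map_add, map_mul]
  mul_mem' := by
    rintro h h' ⟨a, b, hb, H⟩ ⟨a', b', hb', H'⟩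
    refine ⟨a * a', b * b', by simp [hb, hb'], fun y => ?_⟩
    rw [Pi.mul_apply, H, H', div_mul_div_comm]
    simp only [map_mul]
  neg_mem' := by
    rintro h ⟨a, b, hb, H⟩
    refine ⟨-a, b, hb, fun y => ?_⟩
    rw [Pi.neg_apply, H, map_neg, neg_div]

variable (hr0 : 0 < r) (hr : r ≤ 1) {x : C.carrier}

theorem aeval_coord_mem (a : MvPolynomial (Fin (n + 1)) 𝓞_ℂ_[p]) :
    (fun y : Disc r x => MvPolynomial.aeval (coord y) a) ∈ regularRing hr0 hr x :=
  ⟨a, 1, by simp, by simp⟩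

theorem norm_apply_le_one {h : Disc r x → ℂ_[p]} (hh : h ∈ regularRing hr0 hr x) (y : Disc r x) :
    ‖h y‖ ≤ 1 := by
  obtain ⟨a, b, hb, H⟩ := hh
  rw [H, norm_div, norm_aeval_coord_eq_one hr0 hr hb y, div_one]
  exact norm_aeval_le_one (norm_coord_le_one hr y) a

theorem isUnit_of_norm_eq_one (h : regularRing hr0 hr x)
    (h1 : ‖h.1 (Disc.center hr0 x)‖ = 1) : IsUnit h := by
  obtain ⟨a, b, hb, H⟩ := h.2
  have ha : ‖MvPolynomial.aeval (affine (pivot x.1) x.1) a‖ = 1 := by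
    rw [H, norm_div] at h1
    change _ / ‖MvPolynomial.aeval (affine (pivot x.1) x.1) b‖ = 1 at h1
    rw [hb, div_one] at h1
    exact h1
  refine IsUnit.of_mul_eq_one ⟨fun y => MvPolynomial.aeval (coord y) b /
    MvPolynomial.aeval (coord y) a, b, a, ha, fun y => rfl⟩ (Subtype.ext (funext fun y => ?_))
  have ha' : MvPolynomial.aeval (coord y) a ≠ 0 := norm_ne_zero_iff.mp
      (by rw [norm_aeval_coord_eq_one hr0 hr ha y]; exact one_ne_zero)
  have hb' : MvPolynomial.aeval (coord y) b ≠ 0 := norm_ne_zero_iff.mp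
      (by rw [norm_aeval_coord_eq_one hr0 hr hb y]; exact one_ne_zero)
  change h.1 y * (MvPolynomial.aeval (coord y) b / MvPolynomial.aeval (coord y) a) = 1
  rw [H]
  field_simp

/-- Each `h g + 1` has absolute value one at the centre, hence is a unit. This supplies the Jacobson
radical for Nakayama's lemma. -/
theorem mem_jacobson_of_norm_lt_one (h : regularRing hr0 hr x)
    (h1 : ‖h.1 (Disc.center hr0 x)‖ < 1) :
    h ∈ Ideal.jacobson (⊥ : Ideal (regularRing hr0 hr x)) := by
  rw [Ideal.mem_jacobson_bot]
  intro g
  refine isUnit_of_norm_eq_one hr0 hr _ ?_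
  change ‖h.1 (Disc.center hr0 x) * g.1 (Disc.center hr0 x) + 1‖ = 1
  rw [← norm_one (α := ℂ_[p])]
  refine norm_eq_of_norm_sub_lt ?_
  rw [sub_add_cancel_right, norm_neg, norm_mul, norm_one]
  exact (mul_le_of_le_one_right (norm_nonneg _) (norm_apply_le_one hr0 hr g.2 _)).trans_lt h1

variable (x) in
/-- The constant functions with integral values. -/
def constHom : 𝓞_ℂ_[p] →+* regularRing hr0 hr x :=
  RingHom.codRestrict ((Pi.constRingHom (Disc r x) ℂ_[p]).comp (algebraMap 𝓞_ℂ_[p] ℂ_[p]))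
    (regularRing hr0 hr x) fun c => by
      simpa using! aeval_coord_mem hr0 hr (x := x) (MvPolynomial.C c)

/-- The affine coordinates, as elements of the ring of regular functions. -/
def coordFun (x : C.carrier) (j : Fin (n + 1)) : regularRing hr0 hr x :=
  ⟨fun y => coord y j, by simpa using aeval_coord_mem hr0 hr (x := x) (MvPolynomial.X j)⟩

theorem eval₂_constHom_apply (u : Fin (n + 1) → regularRing hr0 hr x)
    (f : MvPolynomial (Fin (n + 1)) 𝓞_ℂ_[p]) (y : Disc r x) :
    (f.eval₂ (constHom hr0 hr x) u).1 y = MvPolynomial.aeval (fun j => (u j).1 y) f := by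
  have := MvPolynomial.hom_eval₂ f (constHom hr0 hr x)
    ((Pi.evalRingHom (fun _ => ℂ_[p]) y).comp (regularRing hr0 hr x).subtype) u
  exact this

variable (x) in
/-- The affine coordinates of the centre of a disc. -/
def centerCoord (j : Fin (n + 1)) : 𝓞_ℂ_[p] :=
  ⟨affine (pivot x.1) x.1 j, (mem_integers_iff p _).mpr (norm_affine_pivot_le x.1 j)⟩

theorem aeval_affine_center (f : MvPolynomial (Fin (n + 1)) 𝓞_ℂ_[p]) :
    MvPolynomial.aeval (affine (pivot x.1) x.1) f =
      ((MvPolynomial.eval (centerCoord x) f : 𝓞_ℂ_[p]) : ℂ_[p]) := by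
  have := MvPolynomial.hom_eval₂ f (RingHom.id 𝓞_ℂ_[p]) (algebraMap 𝓞_ℂ_[p] ℂ_[p]) (centerCoord x)
  exact this.symm

theorem eval_inclPoly (f : MvPolynomial (Fin (n + 1)) 𝓞_ℂ_[p]) (Y : Fin (n + 1) → ℂ_[p]) :
    MvPolynomial.eval Y (inclPoly p f) = MvPolynomial.aeval Y f := by
  rw [inclPoly, MvPolynomial.eval_map, MvPolynomial.aeval_def]

theorem eval_reducePoly_center (f : MvPolynomial (Fin (n + 1)) 𝓞_ℂ_[p]) :
    MvPolynomial.eval (fun j => IsLocalRing.residue 𝓞_ℂ_[p] (centerCoord x j)) (reducePoly p f) =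
      IsLocalRing.residue 𝓞_ℂ_[p] (MvPolynomial.eval (centerCoord x) f) := by
  rw [reducePoly, MvPolynomial.eval_map]
  exact (MvPolynomial.hom_eval₂ f (RingHom.id _) (IsLocalRing.residue 𝓞_ℂ_[p])
    (centerCoord x)).symm

theorem aeval_coord_eq_zero {f : MvPolynomial (Fin (n + 1)) 𝓞_ℂ_[p]}
    (hf : f ∈ C.ideal.comap (inclPoly p)) (hr : r ≤ 1) (y : Disc r x) :
    MvPolynomial.aeval (coord y) f = 0 := by
  have h0 := (affine_sub_of_Delta_lt hr y.2).1
  rw [← eval_inclPoly]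
  refine C.eval_eq_zero_of_mem_ideal hf (affine_ne_zero h0) ?_
  rw [mk_affine h0]
  exact y.1.2

theorem exists_lift_of_mem_reducedIdeal {f : MvPolynomial (Fin (n + 1)) (ResField p)}
    (hf : f ∈ C.reducedIdeal) : ∃ g ∈ C.ideal.comap (inclPoly p), reducePoly p g = f := by
  rw [ProjectiveCurve.reducedIdeal] at hf
  exact (Ideal.mem_map_iff_of_surjective _
    (MvPolynomial.map_surjective _ IsLocalRing.residue_surjective)).mp hf

variable (x) in
theorem eval_residue_center_eq_zero {f : MvPolynomial (Fin (n + 1)) (ResField p)}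
    (hf : f ∈ C.reducedIdeal) :
    MvPolynomial.eval (fun j => IsLocalRing.residue 𝓞_ℂ_[p] (centerCoord x j)) f = 0 := by
  obtain ⟨g, hg, rfl⟩ := exists_lift_of_mem_reducedIdeal hf
  rw [eval_reducePoly_center]
  have h := aeval_coord_eq_zero hg le_rfl (Disc.center one_pos x)
  have h' := aeval_affine_center (x := x) g
  have h'' : MvPolynomial.eval (centerCoord x) g = 0 := Subtype.ext (h'.symm.trans h)
  rw [h'', map_zero]

variable (x) in
theorem centerCoord_pivot : centerCoord x (pivot x.1) = 1 :=
  Subtype.ext (affine_self (rep_pivot_ne_zero x.1))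

/-- On a curve with good reduction, some affine coordinate is a parameter of the disc of a
given centre. -/
theorem exists_parameter (hC : C.HasGoodReduction) (x : C.carrier) :
    ∃ l, ∀ h : regularRing hr0 hr x, ∃ h' : regularRing hr0 hr x, ∀ y,
      h.1 y = h.1 (Disc.center hr0 x) +
        (coord y l - affine (pivot x.1) x.1 l) * h'.1 y := by
  set i := pivot x.1 with hi
  set κ := constHom hr0 hr x with hκ
  set X : Fin (n + 1) → regularRing hr0 hr x := fun j => κ (centerCoord x j) with hX
  set u : Fin (n + 1) → regularRing hr0 hr x := fun j => coordFun hr0 hr x j - X j with hu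
  have hXu : X + u = coordFun hr0 hr x := by
    funext j
    simp [hu]
  have hu_apply : ∀ j y, (u j).1 y = coord y j - affine (pivot x.1) x.1 j := fun j y => rfl
  have hui : u i = 0 := by
    refine Subtype.ext (funext fun y => ?_)
    rw [hu_apply, coord, affine_self (affine_sub_of_Delta_lt hr y.2).1,
      affine_self (rep_pivot_ne_zero x.1), sub_self]
    rfl
  -- The ideal of the coordinate increments `u`. It is finitely generated and, as `u` vanishes at
  -- the centre, contained in the Jacobson radical.
  set M : Ideal (regularRing hr0 hr x) := Ideal.span (Set.range u) with hM
  have huM : ∀ j, u j ∈ M := fun j => Ideal.subset_span ⟨j, rfl⟩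
  set jac := Ideal.jacobson (⊥ : Ideal (regularRing hr0 hr x)) with hjac
  have hMjac : M ≤ jac := by
    rw [hM, Ideal.span_le]
    rintro _ ⟨j, rfl⟩
    refine mem_jacobson_of_norm_lt_one hr0 hr _ ?_
    rw [hu_apply]
    change ‖affine (pivot x.1) x.1 j - affine (pivot x.1) x.1 j‖ < 1
    simp
  have hevalX : ∀ f : MvPolynomial (Fin (n + 1)) 𝓞_ℂ_[p],
      f.eval₂ κ X = κ (MvPolynomial.eval (centerCoord x) f) := fun f =>
    (MvPolynomial.hom_eval₂ f (RingHom.id _) κ (centerCoord x)).symm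
  have hevalC : ∀ (f : MvPolynomial (Fin (n + 1)) 𝓞_ℂ_[p]) y,
      (f.eval₂ κ (coordFun hr0 hr x)).1 y = MvPolynomial.aeval (coord y) f := fun f y =>
    eval₂_constHom_apply hr0 hr _ f y
  have hres1 : IsLocalRing.residue 𝓞_ℂ_[p] (centerCoord x i) = 1 := by
    rw [hi, centerCoord_pivot, map_one]
  obtain ⟨l, -, hl⟩ := IsNonsingular.exists_index hC
    (X := fun j => IsLocalRing.residue 𝓞_ℂ_[p] (centerCoord x j)) hres1
    fun f hf => eval_residue_center_eq_zero x hf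
  -- By Nakayama, it suffices that each `u j` is a multiple of `u l` modulo `jac • M`. Take `g ∈ J`
  -- with reduced gradient `e_j - c e_l`; it vanishes on the disc, so its Taylor expansion gives `u
  -- j ≡ c u l`.
  have hMl : M ≤ Ideal.span {u l} := by
    refine Submodule.le_of_le_smul_of_le_jacobson_bot (I := jac)
      (Submodule.fg_span (Set.finite_range u)) le_rfl ?_
    rw [hM, Ideal.span_le, ← hM]
    rintro _ ⟨j, rfl⟩
    rcases eq_or_ne j i with rfl | hj
    · rw [hui]
      exact Submodule.zero_mem _
    obtain ⟨f, hf, c, hfc⟩ := hl j hj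
    obtain ⟨g, hg, rfl⟩ := exists_lift_of_mem_reducedIdeal hf
    obtain ⟨c, rfl⟩ := IsLocalRing.residue_surjective c
    have hT := eval₂_add_sub_sub_mem κ X u huM g
    have hg0 : g.eval₂ κ (coordFun hr0 hr x) = 0 :=
      Subtype.ext (funext fun y => (hevalC g y).trans (aeval_coord_eq_zero hg hr y))
    have hg1 : g.eval₂ κ X = 0 := by
      have h1 := aeval_coord_eq_zero hg hr (Disc.center hr0 x)
      have h2 : MvPolynomial.eval (centerCoord x) g = 0 :=
        Subtype.ext ((aeval_affine_center (x := x) g).symm.trans h1)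
      rw [hevalX, h2, map_zero]
    rw [hXu, hg0, hg1, sub_zero, zero_sub, neg_mem_iff] at hT
    have hT' : ∑ a, (MvPolynomial.pderiv a g).eval₂ κ X * u a ∈ jac • M := by
      rw [pow_two] at hT
      exact Ideal.mul_mono_left hMjac hT
    -- The gradient is known only after reduction; away from the chart index the discrepancies have
    -- absolute value less than one, and at the chart index `u` is zero.
    set err : Fin (n + 1) → 𝓞_ℂ_[p] := fun a =>
      MvPolynomial.eval (centerCoord x) (MvPolynomial.pderiv a g) -
        ((if a = j then 1 else 0) - if a = l then c else 0) with herr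
    have herr_mem : ∀ a, κ (err a) * u a ∈ jac • M := by
      intro a
      rcases eq_or_ne a i with rfl | ha
      · rw [hui, mul_zero]
        exact Submodule.zero_mem _
      refine Ideal.mul_mem_mul (mem_jacobson_of_norm_lt_one hr0 hr _ ?_) (huM a)
      change ‖((err a : 𝓞_ℂ_[p]) : ℂ_[p])‖ < 1
      refine norm_lt_one_of_residue_eq_zero p ?_
      have h1 := hfc a ha
      rw [reducePoly, MvPolynomial.pderiv_map, eval_reducePoly_center] at h1
      rw [herr]
      simp only [map_sub, h1]
      split_ifs <;> simp
    have hsum : ∑ a, (MvPolynomial.pderiv a g).eval₂ κ X * u a =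
        (u j - κ c * u l) + ∑ a, κ (err a) * u a := by
      have h1 : ∀ a, (MvPolynomial.pderiv a g).eval₂ κ X * u a =
          ((if a = j then u a else 0) - if a = l then κ c * u a else 0) + κ (err a) * u a := by
        intro a
        rw [hevalX, herr]
        simp only [map_sub, apply_ite κ, map_one, map_zero]
        split_ifs <;> ring
      simp only [h1, Finset.sum_add_distrib, Finset.sum_sub_distrib, Finset.sum_ite_eq',
        Finset.mem_univ, if_true]
    have e : u j = κ c * u l + (∑ a, (MvPolynomial.pderiv a g).eval₂ κ X * u a -
        ∑ a, κ (err a) * u a) := by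
      rw [hsum]
      ring
    rw [e]
    exact Submodule.add_mem_sup (Ideal.mul_mem_left _ _ (Ideal.mem_span_singleton_self _))
      (Submodule.sub_mem _ hT' (Submodule.sum_mem _ fun a _ => herr_mem a))
  refine ⟨l, fun h => ?_⟩
  obtain ⟨a, b, hb, H⟩ := h.2
  set v : 𝓞_ℂ_[p] := ⟨h.1 (Disc.center hr0 x),
    (mem_integers_iff p _).mpr (norm_apply_le_one hr0 hr h.2 _)⟩ with hv
  have hbu : IsUnit (b.eval₂ κ (coordFun hr0 hr x)) := by
    refine isUnit_of_norm_eq_one hr0 hr _ ?_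
    rw [hevalC]
    exact hb
  have hbne : ∀ y : Disc r x, MvPolynomial.aeval (coord y) b ≠ 0 := fun y => norm_ne_zero_iff.mp
    (by rw [norm_aeval_coord_eq_one hr0 hr hb y]; exact one_ne_zero)
  -- Clearing the unit denominator turns `h - h(x)` into a polynomial in the coordinates that
  -- vanishes at the centre, hence an element of `M`.
  have hprod : (h - κ v) * b.eval₂ κ (coordFun hr0 hr x) =
      (a - MvPolynomial.C v * b).eval₂ κ (coordFun hr0 hr x) := by
    refine Subtype.ext (funext fun y => ?_)
    rw [hevalC]
    change (h.1 y - (v : ℂ_[p])) * (b.eval₂ κ (coordFun hr0 hr x)).1 y = _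
    rw [hevalC, H y, map_sub, map_mul, MvPolynomial.aeval_C, sub_mul, div_mul_cancel₀ _ (hbne y)]
    rfl
  have hzero : (a - MvPolynomial.C v * b).eval₂ κ X = 0 := by
    rw [hevalX]
    have h1 : MvPolynomial.eval (centerCoord x) (a - MvPolynomial.C v * b) = 0 := by
      refine Subtype.ext ((aeval_affine_center (x := x) _).symm.trans ?_)
      rw [map_sub, map_mul, MvPolynomial.aeval_C]
      have h2 := H (Disc.center hr0 x)
      rw [eq_div_iff (hbne _)] at h2
      exact sub_eq_zero.mpr h2.symm
    rw [h1, map_zero]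
  have hmem : h - κ v ∈ Ideal.span {u l} := by
    refine hMl ((Ideal.mul_unit_mem_iff_mem M hbu).mp ?_)
    have := eval₂_add_sub_mem κ X u huM (a - MvPolynomial.C v * b)
    rwa [hXu, hzero, sub_zero, ← hprod] at this
  obtain ⟨h', hh'⟩ := Ideal.mem_span_singleton.mp hmem
  refine ⟨h', fun y => ?_⟩
  have h1 := congrFun (congrArg Subtype.val hh') y
  change h.1 y - h.1 (Disc.center hr0 x) = (u l).1 y * h'.1 y at h1
  rw [hu_apply] at h1
  linear_combination h1

end Disc

/-! ### The action of a morphism with good reduction on discs. -/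

section Pullback

variable {p : ℕ} [Fact p.Prime] {n : ℕ} {C : ProjectiveCurve ℂ_[p] n} {r : ℝ}

theorem eq_of_affine_eq {x y : ℙ ℂ_[p] (Fin (n + 1) → ℂ_[p])} {i : Fin (n + 1)} (hx : x.rep i ≠ 0)
    (hy : y.rep i ≠ 0) (h : affine i x = affine i y) : x = y := by
  rw [← mk_affine hx, ← mk_affine hy]
  congr 1

/-- On a disc, a morphism with good reduction is given by forms with integral coefficients, one
of which is a unit on the disc. -/
theorem SelfMorphism.HasGoodReduction.exists_forms {φ : SelfMorphism C}
    (hφ : φ.HasGoodReduction) (hr0 : 0 < r) (hr : r ≤ 1) (x : C.carrier) :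
    ∃ (G : Fin (n + 1) → MvPolynomial (Fin (n + 1)) 𝓞_ℂ_[p]) (b : Fin (n + 1)),
      (∀ y : Disc r x, ‖MvPolynomial.aeval (coord y) (G b)‖ = 1) ∧
      ∀ y : Disc r x, ∃ c : ℂ_[p], c ≠ 0 ∧
        (fun j => MvPolynomial.aeval (coord y) (G j)) = c • (φ.toFun y.1).1.rep := by
  have hX0 : (fun j => IsLocalRing.residue 𝓞_ℂ_[p] (centerCoord x j)) ≠ 0 := by
    intro h
    have := congrFun h (pivot x.1)
    simp only [centerCoord_pivot, map_one, Pi.zero_apply] at this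
    exact one_ne_zero this
  obtain ⟨G, ⟨m, hm⟩, hcross, b, hb⟩ := hφ _ hX0 fun f hf => eval_residue_center_eq_zero x hf
  rw [eval_reducePoly_center] at hb
  have hb1 : ‖MvPolynomial.aeval (affine (pivot x.1) x.1) (G b)‖ = 1 := by
    rw [aeval_affine_center]
    exact norm_eq_one_of_residue_ne_zero p hb
  have hby := norm_aeval_coord_eq_one hr0 hr hb1
  refine ⟨G, b, hby, fun y => ?_⟩
  have hm' : ∀ i, (inclPoly p (G i)).IsHomogeneous m := fun i => (hm i).map _
  have hscale : ∀ y : Disc r x, ∀ j, MvPolynomial.aeval (coord y) (G j) =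
      (y.1.1.rep (pivot x.1))⁻¹ ^ m * MvPolynomial.eval y.1.1.rep (inclPoly p (G j)) := by
    intro y j
    rw [← eval_inclPoly, ← eval_smul_of_isHomogeneous (hm' j)]
    rfl
  have hb0 : MvPolynomial.aeval (coord y) (G b) ≠ 0 :=
    norm_ne_zero_iff.mp (by rw [hby]; exact one_ne_zero)
  have hrep := φ.represents (y₀ := y.1) ⟨m, hm'⟩ hcross
    ⟨b, fun h => hb0 (by rw [hscale, h, mul_zero])⟩
  obtain ⟨c, hc⟩ := hrep.exists_eq_smul y.1
  have heq : (fun j => MvPolynomial.aeval (coord y) (G j)) =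
      ((y.1.1.rep (pivot x.1))⁻¹ ^ m * c) • (φ.toFun y.1).1.rep := by
    funext j
    have h1 := congrFun hc j
    simp only [Pi.smul_apply, smul_eq_mul] at h1 ⊢
    rw [hscale, h1, mul_assoc]
  refine ⟨_, fun h0 => hb0 ?_, heq⟩
  rw [h0, zero_smul] at heq
  exact congrFun heq b

/-- A morphism with good reduction does not increase distances, and it pulls regular functions back
to regular functions. -/
theorem SelfMorphism.HasGoodReduction.exists_map {φ : SelfMorphism C} (hφ : φ.HasGoodReduction)
    (hr0 : 0 < r) (hr : r ≤ 1) (x : C.carrier) :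
    ∃ g : Disc r x → Disc r (φ.toFun x), (∀ y, (g y).1 = φ.toFun y.1) ∧
      ∀ h ∈ regularRing hr0 hr (φ.toFun x), h ∘ g ∈ regularRing hr0 hr x := by
  obtain ⟨G, b, hb, hG⟩ := hφ.exists_forms hr0 hr x
  set g : Disc r x → Fin (n + 1) → ℂ_[p] := fun y j => MvPolynomial.aeval (coord y) (G j) with hg
  have hg1 : ∀ y j, ‖g y j‖ ≤ 1 := fun y j => norm_aeval_le_one (norm_coord_le_one hr y) _
  have hg0 : ∀ y, g y ≠ 0 := fun y h => by
    have h1 := hb y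
    have h2 : MvPolynomial.aeval (coord y) (G b) = 0 := congrFun h b
    rw [h2, norm_zero] at h1
    exact zero_ne_one h1
  have hmk : ∀ y, Projectivization.mk ℂ_[p] (g y) (hg0 y) = (φ.toFun y.1).1 := by
    intro y
    obtain ⟨c, -, hc⟩ := hG y
    conv_rhs => rw [← (φ.toFun y.1).1.mk_rep]
    rw [Projectivization.mk_eq_mk_iff']
    exact ⟨c, hc.symm⟩
  set x₀ : Disc r x := Disc.center hr0 x
  have hdelta : ∀ y : Disc r x, Delta p (φ.toFun x).1 (φ.toFun y.1).1 < r := fun y =>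
    Delta_lt_of_norm_sub_lt hr0 (hg0 x₀) (hg0 y) (hmk x₀) (hmk y) (hg1 x₀) (hg1 y) (hb x₀) (hb y)
      fun j => norm_aeval_sub_lt hr0 (norm_coord_le_one hr x₀) (norm_coord_le_one hr y)
        (norm_coord_sub_lt hr y) (G j)
  refine ⟨fun y => ⟨φ.toFun y.1, hdelta y⟩, fun y => rfl, ?_⟩
  set i' := pivot (φ.toFun x).1 with hi'
  -- The value of `G i'` at the centre is maximal because `i'` is a pivot of the image. So `G i'`
  -- may serve as denominator, and the target coordinates `w` are regular on the source disc.
  have hi1 : ‖MvPolynomial.aeval (affine (pivot x.1) x.1) (G i')‖ = 1 := by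
    obtain ⟨c, -, hc⟩ := hG x₀
    have h1 : g x₀ i' = c * (φ.toFun x).1.rep i' := congrFun hc i'
    have h2 : g x₀ b = c * (φ.toFun x).1.rep b := congrFun hc b
    refine le_antisymm (hg1 x₀ i') ?_
    have h3 : ‖g x₀ b‖ = 1 := hb x₀
    change 1 ≤ ‖g x₀ i'‖
    rw [← h3, h1, h2, norm_mul, norm_mul, hi', norm_rep_pivot]
    exact mul_le_mul_of_nonneg_left (norm_le_pi_norm _ _) (norm_nonneg _)
  have hcoord : ∀ (y : Disc r x) j, affine i' (φ.toFun y.1).1 j = g y j / g y i' := by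
    intro y j
    obtain ⟨c, hc0, hc⟩ := hG y
    have h1 : ∀ j, g y j = c * (φ.toFun y.1).1.rep j := fun j => congrFun hc j
    rw [affine_apply, h1, h1, mul_div_mul_left _ _ hc0]
  set w : Fin (n + 1) → regularRing hr0 hr x := fun j =>
    ⟨fun y => affine i' (φ.toFun y.1).1 j, G j, G i', hi1, fun y => hcoord y j⟩ with hw
  rintro h ⟨a, b', hb', H⟩
  have hunit : IsUnit (b'.eval₂ (constHom hr0 hr x) w) := by
    refine isUnit_of_norm_eq_one hr0 hr _ ?_
    rw [eval₂_constHom_apply]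
    exact hb'
  obtain ⟨v, hv⟩ := hunit.exists_right_inv
  have key : h ∘ (fun y : Disc r x => (⟨φ.toFun y.1, hdelta y⟩ : Disc r (φ.toFun x))) =
      (a.eval₂ (constHom hr0 hr x) w * v).1 := by
    funext y
    have h1 := congrFun (congrArg Subtype.val hv) y
    change (b'.eval₂ (constHom hr0 hr x) w).1 y * v.1 y = 1 at h1
    rw [eval₂_constHom_apply] at h1
    change h _ = (a.eval₂ (constHom hr0 hr x) w).1 y * v.1 y
    rw [eval₂_constHom_apply, H]
    have h2 : MvPolynomial.aeval (fun j => (w j).1 y) b' ≠ 0 := left_ne_zero_of_mul_eq_one h1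
    refine (div_eq_iff h2).mpr ?_
    rw [mul_assoc, mul_comm (v.1 y), h1, mul_one]
  rw [key]
  exact (a.eval₂ (constHom hr0 hr x) w * v).2

/-- The target centre is a variable `z` tied by an equation, so that taking `z = x` at a period
gives a genuine self-map of one disc. -/
theorem SelfMorphism.HasGoodReduction.exists_map_iterate {φ : SelfMorphism C}
    (hφ : φ.HasGoodReduction) (hr0 : 0 < r) (hr : r ≤ 1) (N : ℕ) (x z : C.carrier)
    (hz : φ.toFun^[N] x = z) :
    ∃ g : Disc r x → Disc r z, (∀ y, (g y).1 = φ.toFun^[N] y.1) ∧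
      ∀ h ∈ regularRing hr0 hr z, h ∘ g ∈ regularRing hr0 hr x := by
  induction N generalizing x with
  | zero =>
    subst hz
    exact ⟨id, fun y => rfl, fun h hh => hh⟩
  | succ N ih =>
    obtain ⟨g, hg, hg'⟩ := hφ.exists_map hr0 hr x
    obtain ⟨f, hf, hf'⟩ := ih (φ.toFun x) hz
    refine ⟨f ∘ g, fun y => ?_, fun h hh => hg' _ (hf' h hh)⟩
    rw [Function.comp_apply, hf, hg, Function.iterate_succ_apply]

end Pullback

/-! ### Periodic points in a disc and the theorem. -/

section Main

variable {p : ℕ} [Fact p.Prime] {n : ℕ} {C : ProjectiveCurve ℂ_[p] n}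

/-- The periodic points in a disc around a periodic point are fixed points of one iterate. -/
theorem exists_iterate_eq_of_periodic (hC : C.HasGoodReduction) {φ : SelfMorphism C}
    (hφ : φ.HasGoodReduction) {r : ℝ} (hr0 : 0 < r) (hr : r < 1) {x : C.carrier}
    (hx : x ∈ Function.periodicPts φ.toFun) :
    ∃ N ≠ 0, ∀ y ∈ Function.periodicPts φ.toFun, Delta p x.1 y.1 < r → φ.toFun^[N] y = y := by
  obtain ⟨m, hm, hper⟩ := hx
  obtain ⟨f, hf, hf'⟩ := hφ.exists_map_iterate hr0 hr.le m x x hper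
  obtain ⟨l, hl⟩ := exists_parameter hr0 hr.le hC x
  have hfk : ∀ k y, (f^[k] y).1 = (φ.toFun^[m])^[k] y.1 := by
    intro k
    induction k with
    | zero => exact fun y => rfl
    | succ k ih =>
      intro y
      rw [Function.iterate_succ_apply, Function.iterate_succ_apply, ih, hf]
  set x₀ : Disc r x := Disc.center hr0 x
  obtain ⟨N, hN, hN'⟩ := exists_iterate_eq_of_taylor hr0 hr
    (t := fun y : Disc r x => coord y l - affine (pivot x.1) x.1 l) (f := f)
    (fun y => (norm_coord_sub_lt hr.le y l).le) (regularRing hr0 hr.le x)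
    (fun h hh y => norm_apply_le_one hr0 hr.le hh y) x₀ (Subtype.ext ((hf x₀).trans hper))
    (fun c hc => (constHom hr0 hr.le x ⟨c, (mem_integers_iff p c).mpr hc⟩).2)
    (coordFun hr0 hr.le x l - constHom hr0 hr.le x (centerCoord x l)).2
    (sub_self _)
    (fun h hh => by
      obtain ⟨h', hh'⟩ := hl ⟨h, hh⟩
      exact ⟨h'.1, h'.2, hh'⟩)
    hf'
    (fun s s' hss => Subtype.ext (Subtype.ext (eq_of_affine_eq
      (affine_sub_of_Delta_lt hr.le s.2).1 (affine_sub_of_Delta_lt hr.le s'.2).1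
      (funext fun j => hss _ (coordFun hr0 hr.le x j).2))))
  refine ⟨m * N, mul_ne_zero hm.ne' hN, fun y hy hxy => ?_⟩
  obtain ⟨k, hk, hyk⟩ := hy
  -- A period of `y` under `φ` is also one under `φ^m`, so `y` is periodic for the self-map of the
  -- disc.
  have hyk' : (φ.toFun^[m])^[k] y = y := by
    rw [← Function.iterate_mul, mul_comm, Function.iterate_mul]
    exact Function.IsFixedPt.iterate hyk m
  have h1 := hN' ⟨y, hxy⟩ ⟨k, hk, Subtype.ext ((hfk k _).trans hyk')⟩
  rw [Function.iterate_mul, ← hfk N ⟨y, hxy⟩, h1]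

theorem finite_periodic_of_Delta_lt (hC : C.HasGoodReduction) {φ : SelfMorphism C}
    (hφ : φ.HasGoodReduction) (hdeg : 1 < φ.degree) (x : C.carrier) {r : ℝ} (hr : r < 1) :
    {y : C.carrier | y ∈ Function.periodicPts φ.toFun ∧ Delta p x.1 y.1 < r}.Finite := by
  rcases Set.eq_empty_or_nonempty
    {y : C.carrier | y ∈ Function.periodicPts φ.toFun ∧ Delta p x.1 y.1 < r} with h | ⟨z, hz, hxz⟩
  · rw [h]
    exact Set.finite_empty
  have hr0 : 0 < r := by
    refine lt_of_le_of_lt ?_ hxz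
    rw [Delta]
    positivity
  -- The given centre need not be periodic; the disc is recentred at its periodic point `z`.
  obtain ⟨N, hN, hN'⟩ := exists_iterate_eq_of_periodic hC hφ hr0 hr hz
  exact (φ.finite_fixedPoints_iterate hdeg hN).subset fun y hy =>
    hN' y hy.1 (Delta_lt_of_Delta_lt hr0 hr.le hxz hy.2)

end Main

end CurveDynamics

end

theorem mainTheorem2 (p : ℕ) [Fact p.Prime] (n : ℕ)
    (C : CurveDynamics.ProjectiveCurve ℂ_[p] n) (hsmooth : C.IsSmooth)
    (hC : C.HasGoodReduction) (φ : CurveDynamics.SelfMorphism C)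
    (hφ : φ.HasGoodReduction) (hdeg : 1 < φ.degree) :
    (∀ (x : C.carrier) (r : ℝ), r < 1 →
      {y : C.carrier | y ∈ Function.periodicPts φ.toFun ∧
        CurveDynamics.Delta p x.1 y.1 < r}.Finite) ∧
    (∀ y ∈ Function.periodicPts φ.toFun, ∃ ε : ℝ, 0 < ε ∧
      ∀ y' ∈ Function.periodicPts φ.toFun, CurveDynamics.Delta p y.1 y'.1 < ε → y' = y) := by
  have hfin := fun (x : C.carrier) (r : ℝ) (hr : r < 1) =>
    CurveDynamics.finite_periodic_of_Delta_lt hC hφ hdeg x hr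
  refine ⟨hfin, fun y _ => ?_⟩
  -- The least distance from `y` to the finitely many other periodic points within `1/2`, or the
  -- arbitrary value `1` if there are none.
  obtain ⟨ε, hε, hε'⟩ : ∃ ε : ℝ, 0 < ε ∧ ∀ y' ∈ {y' : C.carrier |
      y' ∈ Function.periodicPts φ.toFun ∧ CurveDynamics.Delta p y.1 y'.1 < 1 / 2},
      y' ≠ y → ε ≤ CurveDynamics.Delta p y.1 y'.1 := by
    have h := (hfin y (1 / 2) (by norm_num)).subset (Set.sep_subset _ fun y' => y' ≠ y)
    rcases Set.eq_empty_or_nonempty {y' ∈ {y' : C.carrier | y' ∈ Function.periodicPts φ.toFun ∧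
      CurveDynamics.Delta p y.1 y'.1 < 1 / 2} | y' ≠ y} with h0 | h0
    · exact ⟨1, one_pos, fun y' hy' hne => (h0.subset ⟨hy', hne⟩).elim⟩
    · obtain ⟨z, hz, hmin⟩ := Set.exists_min_image _
        (fun y' : C.carrier => CurveDynamics.Delta p y.1 y'.1) h h0
      exact ⟨_, CurveDynamics.Delta_pos fun h => hz.2 (Subtype.ext h.symm),
        fun y' hy' hne => hmin y' ⟨hy', hne⟩⟩
  refine ⟨min ε (1 / 2), lt_min hε (by norm_num), fun y' hy' hlt => ?_⟩
  by_contra hne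
  exact absurd (hε' y' ⟨hy', hlt.trans_le (min_le_right _ _)⟩ hne)
    (not_le.mpr (hlt.trans_le (min_le_left _ _)))
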